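/- Graphs may have loops and parallel edges. A trail in a graph $G$ is a nonempty sequence $e_1e_2\dots e_n$ of distinct edges that can be oriented so that the head of $e_i$ is the tail of $e_{i+1}$ for $1\le i<n$; its ends are the tail of $e_1$ and the head of $e_n$, and its length is $n$. An immersion of a graph $H$ in $G$ consists of an injective map $\varphi_V\colon V(H)\to V(G)$ and an injective map $\varphi_E$ from $E(H)$ to the set of trails of $G$ such that $\varphi_E(e)$ has ends $\varphi_V(u),\varphi_V(v)$ whenever $e\in E(H)$ has ends $u,v$, and $\varphi_E(e_1),\varphi_E(e_2)$ are edge-disjoint for distinct $e_1,e_2\in E(H)$. The trails $\varphi_E(e)$ are the branch trails, and the immersion is totally even if all of them have even length. Lemma. For every integer $t\ge 0$, every graph $G$ that contains a $K_{70t+71}$-immersion contains a totally even $K_t$-immersion. Moreover, there exists an algorithm (a single one for all $t$) that takes as input a finite graph $G$ and the branch trails of a $K_{70t+71}$-immersion in $G$, for some $t \ge 0$, and returns the branch trails of a totally even $K_t$-immersion in $G$ in $\mathcal{O}_t(|E(G)|)$ time, that is, after at most $C_t\cdot|E(G)|$ steps with $C_t$ depending only on $t$. Here an algorithm is a program of a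 unit-cost random access machine with addition and truncated subtraction; the input graph is stored as a table of the two ends of each edge, and the branch trails are given and returned as a list, in any order, of edge sequences. -/

import Mathlib

open scoped Graph

/-! ### Trails and immersions in multigraphs (loops and parallel edges allowed) -/

/-- `IsWalkFromTo G u T v`: the edges of `T` can be traversed one after the other in the order of
the list, starting at the vertex `u` and finishing at the vertex `v`. -/
def IsWalkFromTo {α β : Type*} (G : Graph α β) : α → List β → α → Prop
  | u, [], v => u ∈ V(G) ∧ u = v
  | u, e :: T, v => ∃ w, G.IsLink e u w ∧ IsWalkFromTo G w T v

/-- `IsTrailWithEnds G T u v`: the sequence `T = e₁ e₂ … eₙ` (`n ≥ 1`) of distinct edges is a trail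
of `G` whose (unordered) ends are `u` and `v`. -/
structure IsTrailWithEnds {α β : Type*} (G : Graph α β) (T : List β) (u v : α) : Prop where
  ne_nil : T ≠ []
  nodup : T.Nodup
  ends : IsWalkFromTo G u T v ∨ IsWalkFromTo G v T u

/-- A (weak) immersion of the graph `H` in the graph `G`. -/
structure Immersion {γ δ α β : Type*} (H : Graph γ δ) (G : Graph α β) where
  /-- the branch vertex of a vertex of `H` -/
  vert : V(H) → V(G)
  /-- the branch trail of an edge of `H` -/
  trail : E(H) → List β
  vert_injective : Function.Injective vert
  trail_injective : Function.Injective trail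
  trail_ends : ∀ (e : E(H)) (u v : V(H)), H.IsLink e u v →
    IsTrailWithEnds G (trail e) (vert u) (vert v)
  edge_disjoint : ∀ e₁ e₂ : E(H), e₁ ≠ e₂ → (trail e₁).Disjoint (trail e₂)

/-- All branch trails have even length. -/
def Immersion.TotallyEven {γ δ α β : Type*} {H : Graph γ δ} {G : Graph α β}
    (φ : Immersion H G) : Prop :=
  ∀ e, Even (φ.trail e).length

/-- The complete graph `K_n`, as a multigraph. -/
def cliqueGraph (n : ℕ) : Graph (Fin n) (Sym2 (Fin n)) :=
  Graph.ofSimpleGraph (⊤ : SimpleGraph (Fin n))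

/-- `L` lists the branch trails of `φ`, each exactly once, in any order. -/
def Immersion.IsTrailList {γ δ α β : Type*} {H : Graph γ δ} {G : Graph α β}
    (φ : Immersion H G) (L : List (List β)) : Prop :=
  L.Nodup ∧ ∀ T, T ∈ L ↔ ∃ e, φ.trail e = T

/-! ### Random access machines with unit cost

The machine has scalar registers `x₀, x₁, …` and arrays `A₀, A₁, …` of natural numbers. A program
is a finite text and so mentions only finitely many registers and arrays. The arithmetic operations
are addition and truncated subtraction (there is no multiplication). Programs are written with
structured control flow; each operation, memory access, assignment and test costs one step. -/

/-- The content of the memory: `reg i` is the register `x_i`, `arr a i` the cell `A_a[i]`. -/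
structure RamState where
  reg : ℕ → ℕ
  arr : ℕ → ℕ → ℕ

/-- Expressions: constants, registers, array cells, sums, truncated differences. -/
inductive RamExpr where
  | const (c : ℕ)
  | reg (i : ℕ)
  | cell (a : ℕ) (index : RamExpr)
  | add (e₁ e₂ : RamExpr)
  | sub (e₁ e₂ : RamExpr)

/-- The value of an expression. -/
def RamExpr.eval (s : RamState) : RamExpr → ℕ
  | const c => c
  | reg i => s.reg i
  | cell a e => s.arr a (e.eval s)
  | add e₁ e₂ => e₁.eval s + e₂.eval s
  | sub e₁ e₂ => e₁.eval s - e₂.eval s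

/-- The number of steps needed to evaluate an expression: one for each of its symbols. -/
def RamExpr.cost : RamExpr → ℕ
  | const _ => 1
  | reg _ => 1
  | cell _ e => e.cost + 1
  | add e₁ e₂ => e₁.cost + e₂.cost + 1
  | sub e₁ e₂ => e₁.cost + e₂.cost + 1

/-- Programs. Tests ask whether the value of an expression is nonzero. -/
inductive RamProg where
  | skip
  | assign (i : ℕ) (e : RamExpr)
  | store (a : ℕ) (index e : RamExpr)
  | seq (p q : RamProg)
  | ite (c : RamExpr) (p q : RamProg)
  | while (c : RamExpr) (p : RamProg)

/-- The state after `x_i := v`. -/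
def RamState.setReg (s : RamState) (i v : ℕ) : RamState :=
  { s with reg := Function.update s.reg i v }

/-- The state after `A_a[k] := v`. -/
def RamState.setCell (s : RamState) (a k v : ℕ) : RamState :=
  { s with arr := Function.update s.arr a (Function.update (s.arr a) k v) }

/-- `RamRuns p s s' k`: started in the state `s`, the program `p` halts after exactly `k` steps,
in the state `s'`. -/
inductive RamRuns : RamProg → RamState → RamState → ℕ → Prop
  | skip (s : RamState) : RamRuns .skip s s 1
  | assign (s : RamState) (i : ℕ) (e : RamExpr) :
      RamRuns (.assign i e) s (s.setReg i (e.eval s)) (e.cost + 1)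
  | store (s : RamState) (a : ℕ) (j e : RamExpr) :
      RamRuns (.store a j e) s (s.setCell a (j.eval s) (e.eval s)) (j.cost + e.cost + 1)
  | seq {p q : RamProg} {s₁ s₂ s₃ : RamState} {k l : ℕ} :
      RamRuns p s₁ s₂ k → RamRuns q s₂ s₃ l → RamRuns (.seq p q) s₁ s₃ (k + l)
  | ite_true {c : RamExpr} {p q : RamProg} {s s' : RamState} {k : ℕ} :
      c.eval s ≠ 0 → RamRuns p s s' k → RamRuns (.ite c p q) s s' (c.cost + 1 + k)
  | ite_false {c : RamExpr} {p q : RamProg} {s s' : RamState} {k : ℕ} :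
      c.eval s = 0 → RamRuns q s s' k → RamRuns (.ite c p q) s s' (c.cost + 1 + k)
  | while_false {c : RamExpr} {p : RamProg} {s : RamState} :
      c.eval s = 0 → RamRuns (.while c p) s s (c.cost + 1)
  | while_true {c : RamExpr} {p : RamProg} {s₁ s₂ s₃ : RamState} {k l : ℕ} :
      c.eval s₁ ≠ 0 → RamRuns p s₁ s₂ k → RamRuns (.while c p) s₂ s₃ l →
      RamRuns (.while c p) s₁ s₃ (c.cost + 1 + k + l)

/-! ### Representation of graphs and of lists of trails in the memory -/

/-- The state `s` stores the graph `G` with vertices `0, …, n - 1` and edges `0, …, m - 1`: the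
register `x₀` holds `n`, the register `x₁` holds `m`, and for each edge `e` the cells `A₀[e]` and
`A₁[e]` hold the two ends of `e`. -/
structure RamState.StoresGraph (s : RamState) {n m : ℕ} (G : Graph (Fin n) (Fin m)) : Prop where
  vertexCount : s.reg 0 = n
  edgeCount : s.reg 1 = m
  ends : ∀ e : Fin m, ∃ u v : Fin n, G.IsLink e u v ∧ s.arr 0 e = u ∧ s.arr 1 e = v

/-- The state `s` stores the list `L` of edge sequences at the register `x_c` and the arrays `A_a`
and `A_b`: `x_c` holds the number of sequences, `A_a` their lengths, and `A_b` their entries, one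
sequence after the other. -/
structure RamState.StoresTrails (s : RamState) (c a b : ℕ) {m : ℕ} (L : List (List (Fin m))) :
    Prop where
  count : s.reg c = L.length
  lengths : ∀ (i : ℕ) (hi : i < L.length), s.arr a i = L[i].length
  entries : ∀ (j : ℕ) (hj : j < L.flatten.length), s.arr b j = (L.flatten[j] : Fin m)

/-! Give every edge of the clique the parity of its branch trail. This is a signed complete graph on
`N = 70 t + 71` vertices, and it suffices to join some `t` of its vertices pairwise by edge-disjoint
even paths with at most three edges (`exists_evenLinkage`); replacing the edges by branch trails
gives the totally even immersion.

Such paths are found greedily. Two vertices `u`, `v` are joined by `u w v` if they agree at `w`,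
that is, if `u w` and `w v` have the same sign. If they agree at no more than `3 t` vertices, an odd
triangle `u w x` with `x` outside these gives an even path `u w x v`, since moving the last edge
from `u` to `v` flips the sign. Earlier paths rule out few choices, so it is enough that every
chosen pair agrees at more than `3 t` vertices or that its first vertex lies in many odd triangles
(`exists_even_detour`). If all vertices lie in many odd triangles, any `t` vertices will do.
Otherwise some `u` lies in few; then most vertices `w` form an odd triangle with `u` and `x` for
fewer than a third of all `x`, and two such `w` with the same sign to `u` agree at more than a third
of all vertices (`exists_agreeing_of_card_oddTriangles_le`).

For the algorithm, only two tasks depend on the size of the graph: finding ends and parities of the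
trails, and copying trails to the output. Both are linear for fixed `t`. Once vertices are renamed
by their first position among the ends, what lies between is a problem about a list `D` of `3 M`
numbers below `2 M + 2`, where `M` is the number of trails. There are finitely many such lists for
each `t`, so a brute-force search for a certificate takes a number of steps bounded in terms of `t`
alone, however slow it is. A certificate exists by the combinatorial part
(`Immersion.IsTrailList.exists_isCert`), and every certificate is sound (`IsCert.exists_immersion`),
so it does not matter which one the search meets first.

The search needs no hand-written code: the check is primitive recursive (`primrec_checkCert`), and
primitive recursive functions are compiled to machine programs (`Nat.Primrec'.exists_prog`). One
program serves all `t`, because a certificate has to name a `t` that fits `M`, and `M` determines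
it. -/

/-! ### A calculus for running programs -/

/-- The program `P`, started in `s`, halts in a state `s'` after `k` steps with `Q s' k`. -/
def Wp (P : RamProg) (Q : RamState → ℕ → Prop) (s : RamState) : Prop :=
  ∃ s' k, RamRuns P s s' k ∧ Q s' k

@[simp]
theorem RamState.setReg_reg (s : RamState) (i v j : ℕ) :
    (s.setReg i v).reg j = if j = i then v else s.reg j := by
  simp [RamState.setReg, Function.update_apply]

@[simp]
theorem RamState.setReg_arr (s : RamState) (i v : ℕ) : (s.setReg i v).arr = s.arr := rfl

@[simp]
theorem RamState.setCell_reg (s : RamState) (a k v : ℕ) : (s.setCell a k v).reg = s.reg := rfl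

@[simp]
theorem RamState.setCell_arr (s : RamState) (a k v b j : ℕ) :
    (s.setCell a k v).arr b j = if b = a ∧ j = k then v else s.arr b j := by
  by_cases h : b = a
  · subst h
    simp [RamState.setCell, Function.update_apply]
  · simp [RamState.setCell, h]

theorem Wp.mono {P : RamProg} {Q Q' : RamState → ℕ → Prop} {s : RamState} (h : Wp P Q s)
    (hQ : ∀ s' k, Q s' k → Q' s' k) : Wp P Q' s := by
  obtain ⟨s', k, hr, hq⟩ := h
  exact ⟨s', k, hr, hQ _ _ hq⟩

theorem Wp.skip {Q : RamState → ℕ → Prop} {s : RamState} (h : Q s 1) : Wp .skip Q s :=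
  ⟨_, _, .skip s, h⟩

theorem Wp.assign {i : ℕ} {e : RamExpr} {Q : RamState → ℕ → Prop} {s : RamState}
    (h : Q (s.setReg i (e.eval s)) (e.cost + 1)) : Wp (.assign i e) Q s :=
  ⟨_, _, .assign s i e, h⟩

theorem Wp.store {a : ℕ} {j e : RamExpr} {Q : RamState → ℕ → Prop} {s : RamState}
    (h : Q (s.setCell a (j.eval s) (e.eval s)) (j.cost + e.cost + 1)) : Wp (.store a j e) Q s :=
  ⟨_, _, .store s a j e, h⟩

theorem Wp.seq {p q : RamProg} {Q : RamState → ℕ → Prop} {s : RamState}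
    (h : Wp p (fun s₁ k => Wp q (fun s₂ l => Q s₂ (k + l)) s₁) s) : Wp (.seq p q) Q s := by
  obtain ⟨s₁, k, h₁, s₂, l, h₂, hq⟩ := h
  exact ⟨_, _, .seq h₁ h₂, hq⟩

theorem Wp.ite {c : RamExpr} {p q : RamProg} {Q : RamState → ℕ → Prop} {s : RamState}
    (h₁ : c.eval s ≠ 0 → Wp p (fun s' k => Q s' (c.cost + 1 + k)) s)
    (h₂ : c.eval s = 0 → Wp q (fun s' k => Q s' (c.cost + 1 + k)) s) : Wp (.ite c p q) Q s := by
  by_cases h : c.eval s = 0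
  · obtain ⟨s', k, hr, hq⟩ := h₂ h
    exact ⟨_, _, .ite_false h hr, hq⟩
  · obtain ⟨s', k, hr, hq⟩ := h₁ h
    exact ⟨_, _, .ite_true h hr, hq⟩

/-- A loop with `n` rounds, of at most `b` steps each, and with the invariant `I`. -/
theorem Wp.while {c : RamExpr} {p : RamProg} (I : ℕ → RamState → Prop) (n b : ℕ)
    (hbody : ∀ j < n, ∀ s, I j s → c.eval s ≠ 0 ∧ Wp p (fun s' k => I (j + 1) s' ∧ k ≤ b) s)
    (hend : ∀ s, I n s → c.eval s = 0) {s : RamState} (hs : I 0 s) :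
    Wp (.while c p) (fun s' k => I n s' ∧ k ≤ n * (b + c.cost + 1) + c.cost + 1) s := by
  have key : ∀ r j s, j + r = n → I j s →
      Wp (.while c p) (fun s' k => I n s' ∧ k ≤ r * (b + c.cost + 1) + c.cost + 1) s := by
    intro r
    induction r with
    | zero =>
      intro j s hj hI
      obtain rfl : j = n := by omega
      exact ⟨s, _, .while_false (hend s hI), hI, by omega⟩
    | succ r ih =>
      intro j s hj hI
      obtain ⟨hc, s₁, k, hr, hI₁, hk⟩ := hbody j (by omega) s hI
      obtain ⟨s₂, l, hr₂, hI₂, hl⟩ := ih (j + 1) s₁ (by omega) hI₁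
      refine ⟨s₂, _, .while_true hc hr hr₂, hI₂, ?_⟩
      rw [add_mul]
      omega
  exact key n 0 s (by omega) hs

/-- A loop with `n` rounds whose exact cost is the sum of the costs of its rounds. -/
theorem Wp.while_exact {c : RamExpr} {p : RamProg} (I : ℕ → RamState → Prop) (n : ℕ) (b : ℕ → ℕ)
    (hbody : ∀ j < n, ∀ s, I j s → c.eval s ≠ 0 ∧ Wp p (fun s' k => I (j + 1) s' ∧ k = b j) s)
    (hend : ∀ s, I n s → c.eval s = 0) {s : RamState} (hs : I 0 s) :
    Wp (.while c p) (fun s' k => I n s' ∧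
      k = (∑ j ∈ Finset.range n, (b j + c.cost + 1)) + c.cost + 1) s := by
  have key : ∀ r j s, j + r = n → I j s → Wp (.while c p) (fun s' k => I n s' ∧
      k = (∑ j ∈ Finset.Ico j n, (b j + c.cost + 1)) + c.cost + 1) s := by
    intro r
    induction r with
    | zero =>
      intro j s hj hI
      obtain rfl : j = n := by omega
      exact ⟨s, _, .while_false (hend s hI), hI, by simp⟩
    | succ r ih =>
      intro j s hj hI
      obtain ⟨hc, s₁, k, hr, hI₁, hk⟩ := hbody j (by omega) s hI
      obtain ⟨s₂, l, hr₂, hI₂, hl⟩ := ih (j + 1) s₁ (by omega) hI₁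
      refine ⟨s₂, _, .while_true hc hr hr₂, hI₂, ?_⟩
      rw [Finset.sum_eq_sum_Ico_succ_bot (by omega)]
      omega
  simpa using key n 0 s (by omega) hs

/-- The program may assign to the register `x_r`. -/
def RamProg.WritesReg (r : ℕ) : RamProg → Prop
  | skip => False
  | assign i _ => r = i
  | store _ _ _ => False
  | seq p q => p.WritesReg r ∨ q.WritesReg r
  | ite _ p q => p.WritesReg r ∨ q.WritesReg r
  | .while _ p => p.WritesReg r

/-- The program may write to the array `A_a`. -/
def RamProg.WritesArr (a : ℕ) : RamProg → Prop
  | skip => False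
  | assign _ _ => False
  | store b _ _ => a = b
  | seq p q => p.WritesArr a ∨ q.WritesArr a
  | ite _ p q => p.WritesArr a ∨ q.WritesArr a
  | .while _ p => p.WritesArr a

theorem RamRuns.reg_eq {P : RamProg} {s s' : RamState} {k : ℕ} (h : RamRuns P s s' k) {r : ℕ}
    (hr : ¬ P.WritesReg r) : s'.reg r = s.reg r := by
  induction h with
  | skip => rfl
  | assign s i e => exact (RamState.setReg_reg ..).trans (if_neg hr)
  | store => rfl
  | seq _ _ ih₁ ih₂ =>
    rw [ih₂ fun h => hr (.inr h), ih₁ fun h => hr (.inl h)]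
  | ite_true _ _ ih => exact ih fun h => hr (.inl h)
  | ite_false _ _ ih => exact ih fun h => hr (.inr h)
  | while_false => rfl
  | while_true _ _ _ ih₁ ih₂ => rw [ih₂ hr, ih₁ hr]

theorem RamRuns.arr_eq {P : RamProg} {s s' : RamState} {k : ℕ} (h : RamRuns P s s' k) {a : ℕ}
    (ha : ¬ P.WritesArr a) : s'.arr a = s.arr a := by
  induction h with
  | skip => rfl
  | assign s i e => rfl
  | store s b j e =>
    have : a ≠ b := ha
    simp [RamState.setCell, this]
  | seq _ _ ih₁ ih₂ =>
    rw [ih₂ fun h => ha (.inr h), ih₁ fun h => ha (.inl h)]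
  | ite_true _ _ ih => exact ih fun h => ha (.inl h)
  | ite_false _ _ ih => exact ih fun h => ha (.inr h)
  | while_false => rfl
  | while_true _ _ _ ih₁ ih₂ => rw [ih₂ ha, ih₁ ha]

/-- Lets the specification of a program mention only what the program changes; all else is preserved
on syntactic grounds. -/
theorem Wp.frame {P : RamProg} {Q : RamState → ℕ → Prop} {s : RamState} (h : Wp P Q s) :
    Wp P (fun s' k => Q s' k ∧ (∀ r, ¬ P.WritesReg r → s'.reg r = s.reg r) ∧
      ∀ a, ¬ P.WritesArr a → s'.arr a = s.arr a) s := by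
  obtain ⟨s', k, hr, hq⟩ := h
  exact ⟨s', k, hr, hq, fun _ => hr.reg_eq, fun _ => hr.arr_eq⟩

/-! ### Primitive recursive functions -/

/-- `P` writes only to the register `x_o`, to registers from `x_b` on, and to no array. -/
def RamProg.WritesOnly (P : RamProg) (o b : ℕ) : Prop :=
  (∀ r, P.WritesReg r → r = o ∨ b ≤ r) ∧ ∀ a, ¬ P.WritesArr a

/-- `P` computes `f` from the registers `ρ 0, ρ 1, …` into the register `o`, in a number of steps
that depends only on the arguments. -/
def RamProg.Computes (P : RamProg) {n : ℕ} (f : List.Vector ℕ n → ℕ) (ρ : Fin n → ℕ) (o : ℕ) :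
    Prop :=
  ∃ κ : List.Vector ℕ n → ℕ, ∀ (v : List.Vector ℕ n) (s : RamState), (∀ i, s.reg (ρ i) = v.get i) →
    Wp P (fun s' k => s'.reg o = f v ∧ k = κ v) s

/-- The values go one by one to the registers from `b` on. Scratch space starts at `b + n`, so later
evaluations spare the earlier results and the arguments. -/
theorem exists_prog_args {m n : ℕ} (g : Fin n → List.Vector ℕ m → ℕ)
    (hg : ∀ i, ∀ (ρ : Fin m → ℕ) (o b : ℕ), (∀ i, ρ i < b) → o < b →
      ∃ P : RamProg, P.WritesOnly o b ∧ P.Computes (g i) ρ o)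
    (ρ : Fin m → ℕ) (b : ℕ) (hρ : ∀ i, ρ i < b) (r : ℕ) (hr : r ≤ n) :
    ∃ P : RamProg, (∀ r, P.WritesReg r → b ≤ r) ∧ (∀ a, ¬ P.WritesArr a) ∧
      ∃ κ : List.Vector ℕ m → ℕ, ∀ (v : List.Vector ℕ m) (s : RamState),
        (∀ i, s.reg (ρ i) = v.get i) →
          Wp P (fun s' k => (∀ i : Fin n, i < r → s'.reg (b + i) = g i v) ∧ k = κ v) s := by
  induction r with
  | zero => exact ⟨.skip, by simp [RamProg.WritesReg], by simp [RamProg.WritesArr], fun _ => 1,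
      fun v s _ => .skip (by simp)⟩
  | succ r ih =>
    obtain ⟨P, hP₁, hP₂, κ, hP⟩ := ih (by omega)
    obtain ⟨P', ⟨hP₁', hP₂'⟩, κ', hP'⟩ :=
      hg ⟨r, hr⟩ ρ (b + r) (b + n) (fun i => (hρ i).trans_le (by omega)) (by omega)
    refine ⟨.seq P P', ?_, ?_, fun v => κ v + κ' v, fun v s hs => ?_⟩
    · rintro x (h | h)
      · exact hP₁ x h
      · have := hP₁' x h
        omega
    · rintro x (h | h)
      · exact hP₂ x h
      · exact hP₂' x h
    · refine .seq ((hP v s hs).frame.mono ?_)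
      rintro s₁ k₁ ⟨⟨h₁, rfl⟩, hreg, -⟩
      have hs₁ : ∀ i, s₁.reg (ρ i) = v.get i := fun i => by
        rw [hreg _ fun h => absurd (hP₁ _ h) (by have := hρ i; omega), hs]
      refine (hP' v s₁ hs₁).frame.mono ?_
      rintro s₂ k₂ ⟨⟨h₂, rfl⟩, hreg₂, -⟩
      refine ⟨fun i hi => ?_, rfl⟩
      rcases Nat.lt_succ_iff_lt_or_eq.1 hi with hi' | hi'
      · rw [hreg₂ _ fun h => absurd (hP₁' _ h) (by have := i.2; omega), h₁ i hi']
      · rw [hi', h₂]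
        congr
        exact hi'.symm

/-- Compilation by induction on the derivation: recursion becomes a counting loop. The running time
is a function of the arguments, which later makes the cost of the search independent of the graph.
-/
theorem Nat.Primrec'.exists_prog {n : ℕ} {f : List.Vector ℕ n → ℕ} (hf : Nat.Primrec' f) :
    ∀ (ρ : Fin n → ℕ) (o b : ℕ), (∀ i, ρ i < b) → o < b →
      ∃ P : RamProg, P.WritesOnly o b ∧ P.Computes f ρ o := by
  induction hf with
  | zero =>
    intro ρ o b _ _
    exact ⟨.assign o (.const 0), ⟨by simp [RamProg.WritesReg], by simp [RamProg.WritesArr]⟩,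
      fun _ => _, fun v s _ => .assign ⟨by simp [RamExpr.eval], rfl⟩⟩
  | succ =>
    intro ρ o b _ _
    exact ⟨.assign o (.add (.reg (ρ 0)) (.const 1)),
      ⟨by simp [RamProg.WritesReg], by simp [RamProg.WritesArr]⟩,
      fun _ => _, fun v s hs => .assign ⟨by simp [RamExpr.eval, hs], rfl⟩⟩
  | get i =>
    intro ρ o b _ _
    exact ⟨.assign o (.reg (ρ i)), ⟨by simp [RamProg.WritesReg], by simp [RamProg.WritesArr]⟩,
      fun _ => _, fun v s hs => .assign ⟨by simp [RamExpr.eval, hs], rfl⟩⟩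
  | @comp m n f g _ _ ihf ihg =>
    intro ρ o b hρ ho
    obtain ⟨P, hP₁, hP₂, κ, hP⟩ := exists_prog_args g ihg ρ b hρ n le_rfl
    obtain ⟨P', ⟨hP₁', hP₂'⟩, κ', hP'⟩ := ihf (fun i => b + i) o (b + n) (by simp) (by omega)
    refine ⟨.seq P P', ⟨?_, ?_⟩, fun v => κ v + κ' (List.Vector.ofFn fun i => g i v),
      fun v s hs => ?_⟩
    · rintro x (h | h)
      · exact .inr (hP₁ x h)
      · have := hP₁' x h
        omega
    · rintro x (h | h)
      · exact hP₂ x h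
      · exact hP₂' x h
    · refine .seq ((hP v s hs).mono ?_)
      rintro s₁ k₁ ⟨h₁, rfl⟩
      refine (hP' (List.Vector.ofFn fun i => g i v) s₁ fun i => ?_).mono ?_
      · simpa using h₁ i i.2
      · rintro s₂ k₂ ⟨h₂, rfl⟩
        exact ⟨h₂, rfl⟩
  | @prec n f g _ _ ihf ihg =>
    intro ρ o b hρ ho
    -- Register `b` counts the rounds, `b + 1` holds the current value, `b + 2` receives the next
    -- one. Register `o` is written only at the very end, so it may coincide with an argument.
    obtain ⟨P, ⟨hP₁, hP₂⟩, κ, hP⟩ := ihf (fun i => ρ i.succ) (b + 1) (b + 3)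
      (fun i => (hρ _).trans_le (by omega)) (by omega)
    obtain ⟨P', ⟨hP₁', hP₂'⟩, κ', hP'⟩ :=
      ihg (Fin.cons b (Fin.cons (b + 1) fun i => ρ i.succ)) (b + 2) (b + 3)
      (fun i => by
        refine Fin.cases (by simp) (fun i => ?_) i
        refine Fin.cases (by simp) (fun i => ?_) i
        have := hρ i.succ
        simp only [Fin.cons_succ]
        omega) (by omega)
    let h : List.Vector ℕ n → ℕ → ℕ := fun v y =>
      Nat.rec (f v) (fun y IH => g (y ::ᵥ IH ::ᵥ v)) y
    refine ⟨.seq P (.seq (.assign b (.const 0)) (.seq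
      (.while (.sub (.reg (ρ 0)) (.reg b)) (.seq P' (.seq (.assign (b + 1) (.reg (b + 2)))
        (.assign b (.add (.reg b) (.const 1))))))
      (.assign o (.reg (b + 1))))), ⟨?_, ?_⟩, fun v => κ v.tail + (2 +
        ((∑ j ∈ Finset.range v.head, ((κ' (j ::ᵥ h v.tail j ::ᵥ v.tail) + (2 + 4)) + 3 + 1) + 3 + 1)
        + 2)),
      fun v s hs => ?_⟩
    · rintro x (h | h | (h | h | h) | h)
      · have := hP₁ x h
        omega
      · exact .inr h.ge
      · have := hP₁' x h
        omega
      · exact .inr (by simp only [RamProg.WritesReg] at h; omega)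
      · exact .inr (by simp only [RamProg.WritesReg] at h; omega)
      · exact .inl h
    · rintro x (h | h | (h | h | h) | h)
      · exact hP₂ x h
      · exact h
      · exact hP₂' x h
      · exact h
      · exact h
      · exact h
    · have hs' : ∀ i : Fin n, s.reg (ρ i.succ) = v.tail.get i := fun i => by
        rw [hs, List.Vector.get_tail_succ]
      refine .seq ((hP v.tail s hs').frame.mono ?_)
      rintro s₁ k₁ ⟨⟨h₁, rfl⟩, hreg, -⟩
      have hs₁ : ∀ i, s₁.reg (ρ i) = v.get i := fun i => by
        have := hρ i
        rw [hreg _ fun h => absurd (hP₁ _ h) (by omega), hs]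
      refine .seq (.assign (.seq ?_))
      refine (Wp.while_exact (fun j s => (∀ i, s.reg (ρ i) = v.get i) ∧ s.reg b = j ∧
        s.reg (b + 1) = h v.tail j) v.head
        (fun j => κ' (j ::ᵥ h v.tail j ::ᵥ v.tail) + (2 + 4)) ?_ ?_ ?_).mono ?_
      · rintro j hj s ⟨hρs, hb, hb₁⟩
        refine ⟨?_, .seq ((hP' (j ::ᵥ h v.tail j ::ᵥ v.tail) s ?_).frame.mono ?_)⟩
        · have := hρs 0
          rw [List.Vector.get_zero] at this
          simp only [RamExpr.eval, this, hb]
          omega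
        · intro i
          refine Fin.cases (by simpa using hb) (fun i => ?_) i
          refine Fin.cases hb₁ (fun i => ?_) i
          simp [hρs, List.Vector.get_tail_succ]
        · rintro s₂ k₂ ⟨⟨h₂, rfl⟩, hreg₂, -⟩
          refine .seq (.assign (.assign ⟨⟨fun i => ?_, ?_, ?_⟩, rfl⟩))
          · have := hρ i
            simp only [RamState.setReg_reg]
            rw [if_neg (by omega), if_neg (by omega), hreg₂ _ fun h => absurd (hP₁' _ h) (by omega),
              hρs]
          · simp only [RamState.setReg_reg, RamExpr.eval]
            simp only [if_true, Nat.ne_of_lt (Nat.lt_succ_self b), if_false]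
            rw [hreg₂ _ fun h => absurd (hP₁' _ h) (by omega), hb]
          · simp [RamExpr.eval, h₂, h]
      · rintro s ⟨hρs, hb, -⟩
        have := hρs 0
        rw [List.Vector.get_zero] at this
        simp [RamExpr.eval, this, hb]
      · refine ⟨fun i => ?_, by simp [RamExpr.eval], ?_⟩
        · have := hρ i
          simp only [RamState.setReg_reg]
          rw [if_neg (by omega), hs₁]
        · simp [h₁, h]
      · rintro s₂ k₂ ⟨⟨-, -, h₂⟩, rfl⟩
        refine .assign ⟨?_, rfl⟩
        simpa [RamExpr.eval] using h₂

/-- Every binary primitive recursive function is computed by a program that takes its arguments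
from the registers `x` and `y` and returns the value in the register `o`. -/
theorem Primrec₂.exists_prog {f : ℕ → ℕ → ℕ} (hf : Primrec₂ f) (x y o b : ℕ) (hx : x < b)
    (hy : y < b) (ho : o < b) :
    ∃ P : RamProg, P.WritesOnly o b ∧ ∃ κ : ℕ → ℕ → ℕ, ∀ s : RamState,
      Wp P (fun s' k => s'.reg o = f (s.reg x) (s.reg y) ∧ k = κ (s.reg x) (s.reg y)) s := by
  obtain ⟨P, hP, κ, h⟩ := (Nat.Primrec'.prim_iff₂.2 hf).exists_prog ![x, y] o b
    (by simp [Fin.forall_fin_two, hx, hy]) ho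
  refine ⟨P, hP, fun x y => κ (x ::ᵥ y ::ᵥ .nil), fun s => ?_⟩
  refine h (s.reg x ::ᵥ s.reg y ::ᵥ .nil) s ?_
  exact Fin.forall_fin_two.2 ⟨rfl, rfl⟩

/-! ### Even paths of length two and three in signed complete graphs -/

section Linkage

variable {V : Type*} [Fintype V] [DecidableEq V]

/-- The vertices whose edges to `u` and `v` have the same sign. -/
def agreeing (s : V → V → ZMod 2) (u v : V) : Finset V :=
  Finset.univ.filter fun w => s u w = s w v

/-- The ordered pairs that form a triangle of odd sign with `u`. -/
def oddTriangles (s : V → V → ZMod 2) (u : V) : Finset (V × V) :=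
  Finset.univ.filter fun p => s u p.1 + s p.1 p.2 + s p.2 u = 1

/-- `A` is the set of the chosen vertices, `B` and `C` are the neighbours already used at `u` and
`v`, and `F` holds the middle edges already used. Many agreeing vertices leave room for a path of
length two; otherwise an odd triangle at `u` is opened up towards `v`. -/
theorem exists_even_detour {s : V → V → ZMod 2} (hs : ∀ x y, s x y = s y x) (hs₀ : ∀ x, s x x = 0)
    {t : ℕ} {u v : V} {A B C : Finset V} {F : Finset (V × V)} (hA : A.card ≤ t) (hB : B.card ≤ t)
    (hC : C.card ≤ t) (hF : F.card ≤ t * t)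
    (h : 3 * t < (agreeing s u v).card ∨
      7 * t * Fintype.card V + t * t < (oddTriangles s u).card) :
    ∃ w x, w ∉ A ∧ x ∉ A ∧ w ∉ B ∧ x ∉ C ∧ (w ≠ x → (w, x) ∉ F) ∧
      s u w + s w x + s x v = 0 := by
  by_cases h' : 3 * t < (agreeing s u v).card
  · obtain ⟨w, hw, hw'⟩ : ∃ w ∈ agreeing s u v, w ∉ A ∪ B ∪ C := by
      apply Finset.exists_mem_notMem_of_card_lt_card
      have := Finset.card_union_le (A ∪ B) C
      have := Finset.card_union_le A B
      omega
    simp only [Finset.mem_union, not_or] at hw'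
    -- A path of length two is a path of length three whose middle step stays at `w`, with sign `0`.
    refine ⟨w, w, hw'.1.1, hw'.1.1, hw'.1.2, hw'.2, by simp, ?_⟩
    have : s u w = s w v := by simpa [agreeing] using hw
    rw [this, hs₀, add_zero]
    exact CharTwo.add_self_eq_zero _
  · obtain ⟨⟨w, x⟩, hp, hp'⟩ : ∃ p ∈ oddTriangles s u,
        p ∉ (A ∪ B) ×ˢ Finset.univ ∪ Finset.univ ×ˢ (A ∪ C ∪ agreeing s u v) ∪ F := by
      apply Finset.exists_mem_notMem_of_card_lt_card
      -- At most `2 t` first vertices and `3 t + 2 t` second vertices are forbidden, each with at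
      -- most `N` partners, where `N` is the number of vertices, and `t * t` further pairs: this is
      -- the bound `7 t N + t * t`.
      refine lt_of_le_of_lt ?_ (h.resolve_left h')
      refine (Finset.card_union_le _ _).trans (add_le_add ?_ hF)
      refine (Finset.card_union_le _ _).trans ?_
      rw [Finset.card_product, Finset.card_product, Finset.card_univ, mul_comm (Fintype.card V),
        ← add_mul]
      refine Nat.mul_le_mul_right _ ?_
      have := Finset.card_union_le A B
      have := Finset.card_union_le (A ∪ C) (agreeing s u v)
      have := Finset.card_union_le A C
      omega
    simp only [Finset.mem_union, Finset.mem_product, Finset.mem_univ, and_true, true_and,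
      not_or] at hp'
    obtain ⟨⟨⟨hwA, hwB⟩, ⟨hxA, hxC⟩, hx⟩, hF⟩ := hp'
    refine ⟨w, x, hwA, hxA, hwB, hxC, fun _ => hF, ?_⟩
    have h₁ : s u w + s w x + s x u = 1 := by simpa [oddTriangles] using hp
    have h₂ : s u x ≠ s x v := by simpa [agreeing] using hx
    rw [hs u x] at h₂
    have : ∀ a b c d : ZMod 2, a + b + c = 1 → c ≠ d → a + b + d = 0 := by decide
    exact this _ _ _ _ h₁ h₂

/-- Paths `S i, nb i j, nb j i, S j` (whose middle step may be degenerate) of even sign that join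
the vertices `S i` pairwise and are edge-disjoint. -/
structure EvenLinkage (s : V → V → ZMod 2) {t : ℕ} (S : Fin t → V) (nb : Fin t → Fin t → V)
    (P : Finset (Fin t × Fin t)) : Prop where
  notMem : ∀ i j, (i, j) ∈ P ∨ (j, i) ∈ P → ∀ k, nb i j ≠ S k
  nb_ne : ∀ i j j', (i, j) ∈ P ∨ (j, i) ∈ P → (i, j') ∈ P ∨ (j', i) ∈ P → j ≠ j' →
    nb i j ≠ nb i j'
  middle_ne : ∀ p ∈ P, ∀ q ∈ P, p ≠ q → nb p.1 p.2 ≠ nb p.2 p.1 →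
    s(nb p.1 p.2, nb p.2 p.1) ≠ s(nb q.1 q.2, nb q.2 q.1)
  even : ∀ p ∈ P, s (S p.1) (nb p.1 p.2) + s (nb p.1 p.2) (nb p.2 p.1) + s (nb p.2 p.1) (S p.2) = 0

/-- Greedy choice, pair by pair: at each stage the forbidden sets are small enough for one more
detour. -/
theorem exists_evenLinkage_of_detours {s : V → V → ZMod 2} (hs : ∀ x y, s x y = s y x)
    (hs₀ : ∀ x, s x x = 0) {t : ℕ} (S : Fin t → V)
    (h : ∀ i j, i < j → 3 * t < (agreeing s (S i) (S j)).card ∨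
      7 * t * Fintype.card V + t * t < (oddTriangles s (S i)).card)
    (P : Finset (Fin t × Fin t)) (hP : ∀ p ∈ P, p.1 < p.2) : ∃ nb, EvenLinkage s S nb P := by
  induction P using Finset.induction_on with
  | empty => exact ⟨fun i _ => S i, by simp, by simp, by simp, by simp⟩
  | insert p P hpP ih =>
    obtain ⟨i, j⟩ := p
    obtain ⟨nb, hnb⟩ := ih fun p hp => hP p (Finset.mem_insert_of_mem hp)
    have hlt : ∀ p ∈ P, p.1 < p.2 := fun p hp => hP p (Finset.mem_insert_of_mem hp)
    have hij : i < j := hP (i, j) (Finset.mem_insert_self _ _)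
    have hji : (j, i) ∉ P := fun h => (hij.trans (hlt _ h)).false
    -- `F` runs over all ordered pairs of indices, so it contains each middle edge in both
    -- orientations and an unordered coincidence is excluded as well.
    obtain ⟨w, x, hwS, hxS, hwi, hxj, hwx, heven⟩ := exists_even_detour hs hs₀ (t := t)
      (u := S i) (v := S j) (A := Finset.univ.image S) (B := Finset.univ.image (nb i))
      (C := Finset.univ.image (nb j))
      (F := Finset.univ.image fun q : Fin t × Fin t => (nb q.1 q.2, nb q.2 q.1))
      (Finset.card_image_le.trans (by simp)) (Finset.card_image_le.trans (by simp))
      (Finset.card_image_le.trans (by simp)) (Finset.card_image_le.trans (by simp)) (h i j hij)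
    simp only [Finset.mem_image, Finset.mem_univ, true_and, not_exists, Prod.mk.injEq,
      Prod.exists] at hwS hxS hwi hxj hwx
    let nb' : Fin t → Fin t → V := fun a b =>
      if a = i ∧ b = j then w else if a = j ∧ b = i then x else nb a b
    have e₁ : nb' i j = w := by simp [nb']
    have e₂ : nb' j i = x := by simp [nb', hij.ne']
    have e₃ : ∀ a b, ((a, b) ∈ P ∨ (b, a) ∈ P) → nb' a b = nb a b := fun a b hab => by
      have h₁ : ¬ (a = i ∧ b = j) := by rintro ⟨rfl, rfl⟩; tauto
      have h₂ : ¬ (a = j ∧ b = i) := by rintro ⟨rfl, rfl⟩; tauto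
      simp [nb', h₁, h₂]
    have hcases : ∀ a b, ((a, b) ∈ insert (i, j) P ∨ (b, a) ∈ insert (i, j) P) →
        (a = i ∧ b = j) ∨ (a = j ∧ b = i) ∨ ((a, b) ∈ P ∨ (b, a) ∈ P) := by
      intro a b hab
      simp only [Finset.mem_insert, Prod.mk.injEq] at hab
      tauto
    refine ⟨nb', fun a b hab k => ?_, fun a b b' hab hab' hbb' => ?_, fun p hp q hq hpq hne => ?_,
      fun p hp => ?_⟩
    · rcases hcases a b hab with ⟨rfl, rfl⟩ | ⟨rfl, rfl⟩ | hab
      · rw [e₁]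
        exact fun h => hwS k h.symm
      · rw [e₂]
        exact fun h => hxS k h.symm
      · rw [e₃ _ _ hab]
        exact hnb.notMem a b hab k
    · rcases hcases a b hab with ⟨rfl, rfl⟩ | ⟨rfl, rfl⟩ | hb <;>
        rcases hcases a b' hab' with ⟨h₁, h₂⟩ | ⟨h₁, h₂⟩ | hb'
      · exact absurd h₂.symm hbb'
      · exact absurd h₁ hij.ne
      · rw [e₁, e₃ _ _ hb']
        exact fun h => hwi _ h.symm
      · exact absurd h₁.symm hij.ne
      · exact absurd h₂.symm hbb'
      · rw [e₂, e₃ _ _ hb']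
        exact fun h => hxj _ h.symm
      · subst h₁ h₂
        rw [e₁, e₃ _ _ hb]
        exact hwi _
      · subst h₁ h₂
        rw [e₂, e₃ _ _ hb]
        exact hxj _
      · rw [e₃ _ _ hb, e₃ _ _ hb']
        exact hnb.nb_ne a b b' hb hb' hbb'
    · obtain ⟨a, b⟩ := p
      obtain ⟨c, d⟩ := q
      simp only [Finset.mem_insert, Prod.mk.injEq] at hp hq
      dsimp only at hne ⊢
      rcases hp with ⟨rfl, rfl⟩ | hp <;> rcases hq with ⟨rfl, rfl⟩ | hq
      · exact absurd rfl hpq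
      · rw [e₁, e₂] at hne ⊢
        rw [e₃ c d (.inl hq), e₃ d c (.inr hq), Ne, Sym2.eq_iff]
        rintro (⟨h₁, h₂⟩ | ⟨h₁, h₂⟩)
        · exact hwx hne c d ⟨h₁.symm, h₂.symm⟩
        · exact hwx hne d c ⟨h₁.symm, h₂.symm⟩
      · rw [e₃ a b (.inl hp), e₃ b a (.inr hp)] at hne ⊢
        rw [e₁, e₂, Ne, Sym2.eq_iff]
        rintro (⟨rfl, rfl⟩ | ⟨rfl, rfl⟩)
        · exact hwx hne a b ⟨rfl, rfl⟩
        · exact hwx hne.symm b a ⟨rfl, rfl⟩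
      · rw [e₃ a b (.inl hp), e₃ b a (.inr hp)] at hne ⊢
        rw [e₃ c d (.inl hq), e₃ d c (.inr hq)]
        exact hnb.middle_ne _ hp _ hq hpq hne
    · obtain ⟨a, b⟩ := p
      dsimp only
      rcases Finset.mem_insert.1 hp with h | hp
      · obtain ⟨rfl, rfl⟩ := Prod.mk.inj h
        rw [e₁, e₂]
        exact heven
      · rw [e₃ a b (.inl hp), e₃ b a (.inr hp)]
        exact hnb.even _ hp

/-- Around a vertex `u` in few odd triangles the signs are nearly balanced: `s w x` is mostly `s u w
+ s u x`. Vertices `w` of one sign class at `u` therefore see most `x` with the same sign. -/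
theorem exists_agreeing_of_card_oddTriangles_le {s : V → V → ZMod 2} (hs : ∀ x y, s x y = s y x)
    {t : ℕ} (hV : 70 * t + 71 ≤ Fintype.card V) {u : V}
    (hu : (oddTriangles s u).card ≤ 7 * t * Fintype.card V + t * t) :
    ∃ S : Fin t → V, Function.Injective S ∧
      ∀ i j, i < j → 3 * t < (agreeing s (S i) (S j)).card := by
  set N := Fintype.card V with hN
  let D : V → Finset V := fun w => Finset.univ.filter fun x => s u w + s w x + s x u = 1
  let high : Finset V := Finset.univ.filter fun w => N ≤ 3 * (D w).card
  -- Double counting gives `high.card * N ≤ 3 * (7 t N + t²)`, and `70 t² ≤ t N` lets the extra `3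
  -- t²` fit into one more `t N`.
  have hhigh : high.card ≤ 22 * t := by
    have h₁ : high.card * N ≤ 3 * (oddTriangles s u).card := by
      have : (oddTriangles s u).card = ∑ w, (D w).card := by
        rw [Finset.card_eq_sum_card_fiberwise (f := Prod.fst) (t := Finset.univ) (by simp)]
        refine Finset.sum_congr rfl fun w _ => ?_
        refine Finset.card_bij' (fun p _ => p.2) (fun x _ => (w, x)) ?_ ?_ ?_ ?_
        · rintro ⟨a, b⟩ h
          simp only [oddTriangles, Finset.mem_filter, Finset.mem_univ, true_and] at h
          obtain ⟨h, rfl⟩ := h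
          simpa [D] using h
        · intro x hx
          simpa [oddTriangles, D] using hx
        · rintro ⟨a, b⟩ h
          simp only [Finset.mem_filter] at h
          rw [← h.2]
        · intro x _
          rfl
      rw [this, Finset.mul_sum, ← smul_eq_mul]
      refine (Finset.card_nsmul_le_sum high (fun w => 3 * (D w).card) N fun w hw => ?_).trans ?_
      · simpa [high] using hw
      · exact Finset.sum_le_sum_of_subset (Finset.subset_univ _)
    have h₂ : t * t ≤ t * N := Nat.mul_le_mul_left _ (by omega)
    have h₄ : 70 * (t * t) ≤ t * N := by nlinarith
    have h₃ : high.card * N ≤ (22 * t) * N := by nlinarith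
    exact Nat.le_of_mul_le_mul_right h₃ (by omega)
  -- At least `48 t + 71` vertices are left, so one of the two sign classes at `u` contains `t` of
  -- them.
  obtain ⟨c, hc⟩ : ∃ c, t ≤ ((Finset.univ \ high).filter fun w => s u w = c).card := by
    by_contra! hcon
    have h₁ := Finset.card_eq_sum_card_fiberwise (f := fun w => s u w) (s := Finset.univ \ high)
      (t := Finset.univ) (by simp)
    have h₂ := Finset.le_card_sdiff high Finset.univ
    rw [Finset.card_univ, ← hN] at h₂
    have h₃ : ∑ c : ZMod 2, ((Finset.univ \ high).filter fun w => s u w = c).card ≤ 2 * t := by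
      refine (Finset.sum_le_card_nsmul _ _ t fun c _ => (hcon c).le).trans ?_
      simp [ZMod.card]
    omega
  obtain ⟨S⟩ : Nonempty (Fin t ↪ {w // w ∈ (Finset.univ \ high).filter fun w => s u w = c}) := by
    apply Function.Embedding.nonempty_of_card_le
    rwa [Fintype.card_coe, Fintype.card_fin]
  refine ⟨fun i => S i, fun i j hij => S.injective (Subtype.ext hij), fun i j _ => ?_⟩
  have hS : ∀ i, 3 * (D (S i)).card < N ∧ s u (S i) = c := fun i => by
    have h := Finset.mem_filter.1 (S i).2
    exact ⟨by simpa [high] using h.1, h.2⟩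
  -- If the triangles of `u`, `x` with `S i` and with `S j` are both even, the equal signs at `u`
  -- force equal signs at `x`. Each `D` has fewer than `N / 3` elements, so more than `N / 3`
  -- vertices `x` remain.
  have hsub : Finset.univ \ (D (S i) ∪ D (S j)) ⊆ agreeing s (S i) (S j) := by
    intro x hx
    simp only [Finset.mem_sdiff, Finset.mem_univ, Finset.mem_union, true_and, not_or, D,
      Finset.mem_filter] at hx
    simp only [agreeing, Finset.mem_filter, Finset.mem_univ, true_and]
    rw [hs x (S j : V)]
    rw [(hS i).2, (hS j).2] at hx
    have : ∀ a b b' d : ZMod 2, ¬ a + b + d = 1 ∧ ¬ a + b' + d = 1 → b = b' := by decide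
    exact this _ _ _ _ hx
  have h₁ := Finset.card_le_card hsub
  have h₂ := Finset.le_card_sdiff (D (S i) ∪ D (S j)) Finset.univ
  have h₃ := Finset.card_union_le (D (S i)) (D (S j))
  rw [Finset.card_univ, ← hN] at h₂
  have := (hS i).1
  have := (hS j).1
  change 3 * t < (agreeing s (S i : V) (S j)).card
  omega

/-- In every signed complete graph on `70 t + 71` vertices, some `t` vertices can be joined pairwise
by edge-disjoint paths of even sign. -/
theorem exists_evenLinkage {s : V → V → ZMod 2} (hs : ∀ x y, s x y = s y x)
    (hs₀ : ∀ x, s x x = 0) {t : ℕ} (hV : 70 * t + 71 ≤ Fintype.card V) :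
    ∃ (S : Fin t → V) (nb : Fin t → Fin t → V), Function.Injective S ∧
      EvenLinkage s S nb (Finset.univ.filter fun p => p.1 < p.2) := by
  -- The threshold is the one that `exists_even_detour` needs for opening up a triangle.
  by_cases h : ∀ u, 7 * t * Fintype.card V + t * t < (oddTriangles s u).card
  · obtain ⟨S⟩ : Nonempty (Fin t ↪ V) := by
      apply Function.Embedding.nonempty_of_card_le
      rw [Fintype.card_fin]
      omega
    obtain ⟨nb, hnb⟩ := exists_evenLinkage_of_detours hs hs₀ S (fun i j _ => .inr (h (S i)))
      (Finset.univ.filter fun p => p.1 < p.2) (by simp)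
    exact ⟨S, nb, S.injective, hnb⟩
  · push Not at h
    obtain ⟨u, hu⟩ := h
    obtain ⟨S, hS, hag⟩ := exists_agreeing_of_card_oddTriangles_le hs hV hu
    obtain ⟨nb, hnb⟩ := exists_evenLinkage_of_detours hs hs₀ S (fun i j hij => .inl (hag i j hij))
      (Finset.univ.filter fun p => p.1 < p.2) (by simp)
    exact ⟨S, nb, hS, hnb⟩

end Linkage

/-! ### Walks given by edge sequences -/

section Walks

variable {α β : Type*} {G : Graph α β}

theorem IsWalkFromTo.right_mem {T : List β} {u v : α} (h : IsWalkFromTo G u T v) : v ∈ V(G) := by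
  induction T generalizing u with
  | nil => exact h.2 ▸ h.1
  | cons e T ih =>
    obtain ⟨w, -, h⟩ := h
    exact ih h

theorem IsWalkFromTo.left_mem {T : List β} {u v : α} (h : IsWalkFromTo G u T v) : u ∈ V(G) := by
  cases T with
  | nil => exact h.1
  | cons e T =>
    obtain ⟨w, h, -⟩ := h
    exact h.left_mem

theorem IsWalkFromTo.append {T T' : List β} {u v w : α} (h : IsWalkFromTo G u T v)
    (h' : IsWalkFromTo G v T' w) : IsWalkFromTo G u (T ++ T') w := by
  induction T generalizing u with
  | nil =>
    obtain ⟨-, rfl⟩ := h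
    exact h'
  | cons e T ih =>
    obtain ⟨x, hx, h⟩ := h
    exact ⟨x, hx, ih h⟩

theorem IsWalkFromTo.reverse {T : List β} {u v : α} (h : IsWalkFromTo G u T v) :
    IsWalkFromTo G v T.reverse u := by
  induction T generalizing u with
  | nil =>
    obtain ⟨hu, rfl⟩ := h
    exact ⟨hu, rfl⟩
  | cons e T ih =>
    obtain ⟨x, hx, h⟩ := h
    rw [List.reverse_cons]
    exact (ih h).append ⟨u, hx.symm, hx.left_mem, rfl⟩

theorem IsWalkFromTo.right_unique {T : List β} {u v v' : α} (h : IsWalkFromTo G u T v)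
    (h' : IsWalkFromTo G u T v') : v = v' := by
  induction T generalizing u with
  | nil => exact h.2.symm.trans h'.2
  | cons e T ih =>
    obtain ⟨x, hx, h⟩ := h
    obtain ⟨y, hy, h'⟩ := h'
    obtain rfl := hx.right_unique hy
    exact ih h h'

/-- If an edge sequence can be traversed from two different vertices, all its edges join these. -/
theorem IsWalkFromTo.ends_of_ne {T : List β} {a b c d : α} (h : IsWalkFromTo G a T b)
    (h' : IsWalkFromTo G c T d) (hac : a ≠ c) : (b = a ∧ d = c) ∨ (b = c ∧ d = a) := by
  induction T generalizing a c with
  | nil => exact .inl ⟨h.2.symm, h'.2.symm⟩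
  | cons e T ih =>
    obtain ⟨x, hx, h⟩ := h
    obtain ⟨y, hy, h'⟩ := h'
    rcases hx.eq_and_eq_or_eq_and_eq hy with ⟨rfl, -⟩ | ⟨rfl, rfl⟩
    · exact absurd rfl hac
    · exact (ih h h' hac.symm).symm

/-- An edge sequence with distinct ends determines these ends up to order. Hence any successful
traversal of a branch trail, from whichever start, finds the right branch vertices. -/
theorem IsWalkFromTo.ends_eq_or_eq {T : List β} {a b u v : α} (h : IsWalkFromTo G a T b)
    (h' : IsWalkFromTo G u T v ∨ IsWalkFromTo G v T u) (huv : u ≠ v) :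
    (a = u ∧ b = v) ∨ (a = v ∧ b = u) := by
  wlog hw : IsWalkFromTo G u T v generalizing u v
  · exact (this h'.symm huv.symm (h'.resolve_left hw)).symm
  by_cases hau : a = u
  · subst hau
    exact .inl ⟨rfl, h.right_unique hw⟩
  · rcases h.ends_of_ne hw hau with ⟨-, h⟩ | ⟨h₁, h₂⟩
    · exact absurd h.symm huv
    · exact .inr ⟨h₂.symm, h₁⟩

end Walks

theorem cliqueGraph_isLink {n : ℕ} {e : Sym2 (Fin n)} {u v : Fin n} :
    (cliqueGraph n).IsLink e u v ↔ e = s(u, v) ∧ u ≠ v := by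
  simp only [cliqueGraph, Graph.ofSimpleGraph_isLink]
  constructor
  · rintro ⟨rfl, h⟩
    exact ⟨rfl, by simpa using h⟩
  · rintro ⟨rfl, h⟩
    exact ⟨rfl, by simpa using h⟩

theorem mem_cliqueGraph_edgeSet {n : ℕ} {u v : Fin n} : s(u, v) ∈ E(cliqueGraph n) ↔ u ≠ v := by
  simp [cliqueGraph]

/-- An immersion of a complete graph from a family of edge-disjoint trails indexed by `Fin Q`. -/
theorem exists_immersion_of_trails {α β : Type*} {G : Graph α β} {t Q : ℕ} (v : Fin t → V(G))
    (hv : Function.Injective v) (U : Fin Q → List β) (pr : Fin Q → Fin t × Fin t)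
    (hpr : Function.Injective pr) (hlt : ∀ r, (pr r).1 < (pr r).2)
    (hsurj : ∀ i j, i < j → ∃ r, pr r = (i, j))
    (hwalk : ∀ r, IsWalkFromTo G (v (pr r).1) (U r) (v (pr r).2)) (hnodup : ∀ r, (U r).Nodup)
    (hdisj : ∀ r r', r ≠ r' → (U r).Disjoint (U r')) (heven : ∀ r, Even (U r).length) :
    ∃ ψ : Immersion (cliqueGraph t) G, ψ.TotallyEven ∧ ψ.IsTrailList (List.ofFn U) := by
  -- An empty sequence would join a branch vertex to itself. Nonemptiness also turns disjointness
  -- into injectivity of `U` below.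
  have hne : ∀ r, U r ≠ [] := fun r h => by
    have := hwalk r
    rw [h] at this
    exact (hlt r).ne (hv (Subtype.ext this.2))
  have hidx : ∀ e : E(cliqueGraph t), ∃ r, s((pr r).1, (pr r).2) = e.1 := by
    rintro ⟨e, he⟩
    induction e with | h i j =>
    rcases (mem_cliqueGraph_edgeSet.1 he).lt_or_gt with hij | hij
    · obtain ⟨r, hr⟩ := hsurj i j hij
      exact ⟨r, by simp [hr]⟩
    · obtain ⟨r, hr⟩ := hsurj j i hij
      exact ⟨r, by simp [hr, Sym2.eq_swap]⟩
  choose idx hidx using hidx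
  have hinj : Function.Injective idx := fun e e' h => Subtype.ext <| by
    rw [← hidx e, ← hidx e', h]
  have hU : Function.Injective U := fun r r' h => by
    by_contra hrr
    obtain ⟨e, he⟩ := List.exists_mem_of_ne_nil _ (hne r)
    exact hdisj r r' hrr he (h ▸ he)
  refine ⟨⟨fun i => v i, fun e => U (idx e), hv.comp Subtype.val_injective, hU.comp hinj, fun e i j hij => ⟨hne _, hnodup _, ?_⟩,
    fun e e' h => hdisj _ _ fun h' => h (hinj h')⟩, fun e => heven _,
    List.nodup_ofFn.2 hU, fun T => ?_⟩
  · have h₁ := (cliqueGraph_isLink.1 hij).1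
    rw [← hidx e, Sym2.eq_iff] at h₁
    have h₂ := hwalk (idx e)
    rcases h₁ with ⟨h, h'⟩ | ⟨h, h'⟩
    · rw [h, h'] at h₂
      exact .inl h₂
    · rw [h, h'] at h₂
      exact .inr h₂
  · rw [List.mem_ofFn]
    constructor
    · rintro ⟨r, rfl⟩
      have he : s((pr r).1, (pr r).2) ∈ E(cliqueGraph t) := mem_cliqueGraph_edgeSet.2 (hlt r).ne
      refine ⟨⟨_, he⟩, congrArg U (hpr ?_)⟩
      have h := hidx ⟨_, he⟩
      rw [Sym2.eq_iff] at h
      rcases h with ⟨h, h'⟩ | ⟨h, h'⟩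
      · exact Prod.ext h h'
      · have := hlt (idx ⟨_, he⟩)
        rw [h, h'] at this
        exact absurd this (hlt r).not_gt
    · rintro ⟨e, rfl⟩
      exact ⟨_, rfl⟩

/-! ### Certificates

The branch trails `L` of an immersion of a complete graph, with ends `f (2 * k)` and `f (2 * k + 1)`
of the `k`-th trail, are summarised in a list `D` of numbers: labels of the ends, then the parities
of the trails. A certificate for `D` describes a totally even immersion whose branch trails are
concatenations of three pieces, where the piece `2 * k` stands for the `k`-th trail, `2 * k + 1`
for its reverse, and `2 * L.length` for the empty sequence. -/

/-- The first position of the value `x`. -/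
noncomputable def firstIndex {α : Type*} (f : ℕ → α) (x : α) : ℕ := sInf {r | f r = x}

theorem apply_firstIndex {α : Type*} (f : ℕ → α) (e : ℕ) : f (firstIndex f (f e)) = f e :=
  Nat.sInf_mem (s := {r | f r = f e}) ⟨e, rfl⟩

theorem firstIndex_le {α : Type*} (f : ℕ → α) (e : ℕ) : firstIndex f (f e) ≤ e :=
  Nat.sInf_le (s := {r | f r = f e}) rfl

/-- The labels of the ends of the trails, and the parities of the trails. -/
noncomputable def trailData {α β : Type*} (f : ℕ → α) (L : List (List β)) : List ℕ :=
  (List.range (2 * L.length)).map (fun e => firstIndex f (f e)) ++ L.map fun T => T.length % 2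

/-- The `i`-th entry of the `n`-th list of a certificate. -/
def certEntry (c : List (List ℕ)) (n i : ℕ) : ℕ := (c.getD n []).getD i 0

/-- The piece `z` leads from the label `x` to the label `y`. -/
def IsPiece (D : List ℕ) (z x y : ℕ) : Prop :=
  (z < 2 * (D.length / 3) ∧ D.getD z 0 = x ∧ D.getD (4 * (z / 2) + 1 - z) 0 = y) ∨
    (z = 2 * (D.length / 3) ∧ x = y)

/-- The parity of the piece `z`. -/
def pieceParity (D : List ℕ) (z : ℕ) : ℕ := D.getD (2 * (D.length / 3) + z / 2) 0

/-- The lists `1`, …, `5` of the certificate `c` hold the labels of the branch vertices, the two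
ends of each branch trail, the pieces, and the intermediate labels on the branch trails. -/
structure IsCert (D : List ℕ) (c : List (List ℕ)) : Prop where
  order : (70 * certEntry c 0 0 + 71) * (70 * certEntry c 0 0 + 70) = 2 * (D.length / 3)
  label : ∀ i < certEntry c 0 0, certEntry c 1 i < 2 * (D.length / 3) ∧
    D.getD (certEntry c 1 i) 0 = certEntry c 1 i
  label_ne : ∀ i < certEntry c 0 0, ∀ j < i, certEntry c 1 i ≠ certEntry c 1 j
  ends_lt : ∀ r < certEntry c 0 1, certEntry c 2 r < certEntry c 3 r ∧
    certEntry c 3 r < certEntry c 0 0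
  ends_ne : ∀ r < certEntry c 0 1, ∀ r' < r, ¬ (certEntry c 2 r = certEntry c 2 r' ∧
    certEntry c 3 r = certEntry c 3 r')
  ends_surj : ∀ j < certEntry c 0 0, ∀ i < j, ∃ r < certEntry c 0 1, certEntry c 2 r = i ∧
    certEntry c 3 r = j
  isPiece : ∀ r < certEntry c 0 1,
    IsPiece D (certEntry c 4 (3 * r)) (certEntry c 1 (certEntry c 2 r)) (certEntry c 5 (2 * r)) ∧
    IsPiece D (certEntry c 4 (3 * r + 1)) (certEntry c 5 (2 * r)) (certEntry c 5 (2 * r + 1)) ∧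
    IsPiece D (certEntry c 4 (3 * r + 2)) (certEntry c 5 (2 * r + 1))
      (certEntry c 1 (certEntry c 3 r))
  even : ∀ r < certEntry c 0 1, (pieceParity D (certEntry c 4 (3 * r)) +
    pieceParity D (certEntry c 4 (3 * r + 1)) + pieceParity D (certEntry c 4 (3 * r + 2))) % 2 = 0
  piece_ne : ∀ q < 3 * certEntry c 0 1, ∀ q' < q,
    certEntry c 4 q / 2 = certEntry c 4 q' / 2 → certEntry c 4 q / 2 = D.length / 3

/-- The edge sequence of the piece `z`. -/
def piece {β : Type*} (L : List (List β)) (z : ℕ) : List β :=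
  if z % 2 = 0 then L.getD (z / 2) [] else (L.getD (z / 2) []).reverse

/-- The `r`-th branch trail described by the certificate `c`. -/
def certTrail {β : Type*} (L : List (List β)) (c : List (List ℕ)) (r : ℕ) : List β :=
  piece L (certEntry c 4 (3 * r)) ++ piece L (certEntry c 4 (3 * r + 1)) ++
    piece L (certEntry c 4 (3 * r + 2))

/-- The branch trails described by the certificate `c`. -/
def certTrails {β : Type*} (L : List (List β)) (c : List (List ℕ)) : List (List β) :=
  (List.range (certEntry c 0 1)).map (certTrail L c)

/-! ### From certificates to immersions. -/

section Soundness

variable {α β : Type*} {G : Graph α β} {f : ℕ → α} {L : List (List β)}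

@[simp]
theorem length_trailData : (trailData f L).length = 3 * L.length := by
  simp only [trailData, List.length_append, List.length_map, List.length_range]
  omega

theorem trailData_getD_of_lt {e : ℕ} (he : e < 2 * L.length) :
    (trailData f L).getD e 0 = firstIndex f (f e) := by
  rw [trailData, List.getD_append _ _ _ _ (by simpa using he)]
  simp [he]

/-- For the empty piece `2 * L.length` the position is `3 * L.length`, just past the end of the
list, and the default value `0` is the correct parity. -/
theorem pieceParity_trailData (z : ℕ) :
    pieceParity (trailData f L) z = (piece L z).length % 2 := by
  have h : (piece L z).length = (L.getD (z / 2) []).length := by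
    rw [piece]
    split <;> simp
  rw [h, pieceParity, length_trailData, Nat.mul_div_cancel_left _ (by norm_num), trailData,
    List.getD_append_right _ _ _ _ (by simp)]
  simp only [List.length_map, List.length_range, Nat.add_sub_cancel_left]
  by_cases hz : z / 2 < L.length
  · simp [hz]
  · simp [Nat.le_of_not_lt hz]

theorem mem_piece {z : ℕ} {e : β} : e ∈ piece L z ↔ e ∈ L.getD (z / 2) [] := by
  rw [piece]
  split <;> simp

theorem piece_eq_nil {z : ℕ} (hz : L.length ≤ z / 2) : piece L z = [] := by
  rw [piece, List.getD_eq_default _ _ hz]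
  simp

theorem nodup_piece (hL : L.flatten.Nodup) (z : ℕ) : (piece L z).Nodup := by
  by_cases hz : z / 2 < L.length
  · have := (List.nodup_flatten.1 hL).1 _ (List.getElem_mem hz)
    rw [piece, List.getD_eq_getElem _ _ hz]
    split
    · exact this
    · exact List.nodup_reverse.2 this
  · simp [piece_eq_nil (Nat.le_of_not_lt hz)]

theorem disjoint_piece (hL : L.flatten.Nodup) {z z' : ℕ} (h : z / 2 = z' / 2 → L.length ≤ z / 2) :
    (piece L z).Disjoint (piece L z') := by
  have key : ∀ i j, i < L.length → j < L.length → i < j →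
      (L.getD i []).Disjoint (L.getD j []) := fun i j hi hj hij => by
    rw [List.getD_eq_getElem _ _ hi, List.getD_eq_getElem _ _ hj]
    exact List.pairwise_iff_getElem.1 (List.nodup_flatten.1 hL).2 i j hi hj hij
  by_cases hz : z / 2 < L.length
  · by_cases hz' : z' / 2 < L.length
    · intro e he he'
      rw [mem_piece] at he he'
      rcases lt_trichotomy (z / 2) (z' / 2) with hlt | heq | hlt
      · exact key _ _ hz hz' hlt he he'
      · exact hz.not_ge (h heq)
      · exact key _ _ hz' hz hlt he' he
    · simp [piece_eq_nil (Nat.le_of_not_lt hz')]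
  · simp [piece_eq_nil (Nat.le_of_not_lt hz)]

/-- `4 * (z / 2) + 1 - z` exchanges `2 * k` and `2 * k + 1`, so it is the position of the other end
of the trail. A label is a position with the same vertex, hence applying `f` to labels recovers the
vertices. -/
theorem IsPiece.isWalkFromTo
    (hf : ∀ (k : ℕ) (hk : k < L.length), IsWalkFromTo G (f (2 * k)) L[k] (f (2 * k + 1)))
    {z x y : ℕ} (h : IsPiece (trailData f L) z x y) (hx : f x ∈ V(G)) :
    IsWalkFromTo G (f x) (piece L z) (f y) := by
  rw [IsPiece, length_trailData, Nat.mul_div_cancel_left _ (by norm_num)] at h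
  rcases h with ⟨hz, rfl, rfl⟩ | ⟨rfl, rfl⟩
  · have hz' : z / 2 < L.length := by omega
    rw [trailData_getD_of_lt hz, apply_firstIndex f, trailData_getD_of_lt (by omega),
      apply_firstIndex f, piece, List.getD_eq_getElem _ _ hz']
    rcases Nat.mod_two_eq_zero_or_one z with h | h
    · rw [if_pos h]
      convert hf _ hz' using 2 <;> omega
    · rw [if_neg (by omega)]
      convert (hf _ hz').reverse using 2 <;> omega
  · rw [piece_eq_nil (by omega)]
    exact ⟨hx, rfl⟩

/-- A certificate describes a totally even immersion. -/
theorem IsCert.exists_immersion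
    (hf : ∀ (k : ℕ) (hk : k < L.length), IsWalkFromTo G (f (2 * k)) L[k] (f (2 * k + 1)))
    (hL : L.flatten.Nodup) {c : List (List ℕ)} (hc : IsCert (trailData f L) c) :
    ∃ ψ : Immersion (cliqueGraph (certEntry c 0 0)) G, ψ.TotallyEven ∧
      ψ.IsTrailList (certTrails L c) := by
  have hM : (trailData f L).length / 3 = L.length := by
    rw [length_trailData, Nat.mul_div_cancel_left _ (by norm_num)]
  have hmem : ∀ e < 2 * L.length, f e ∈ V(G) := fun e he => by
    rcases Nat.even_or_odd' e with ⟨k, rfl | rfl⟩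
    · exact (hf k (by omega)).left_mem
    · exact (hf k (by omega)).right_mem
  have hlab : ∀ i < certEntry c 0 0, f (certEntry c 1 i) ∈ V(G) := fun i hi =>
    hmem _ (hM ▸ (hc.label i hi).1)
  have hlab' : ∀ i < certEntry c 0 0,
      firstIndex f (f (certEntry c 1 i)) = certEntry c 1 i := fun i hi => by
    rw [← trailData_getD_of_lt (L := L) (hM ▸ (hc.label i hi).1)]
    exact (hc.label i hi).2
  have hdisj : ∀ q < 3 * certEntry c 0 1, ∀ q' < 3 * certEntry c 0 1, q ≠ q' →
      (piece L (certEntry c 4 q)).Disjoint (piece L (certEntry c 4 q')) := by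
    intro q hq q' hq' hne
    refine disjoint_piece hL fun h => ?_
    rcases hne.lt_or_gt with hlt | hlt
    · rw [h, hc.piece_ne q' hq' q hlt h.symm, hM]
    · rw [hc.piece_ne q hq q' hlt h, hM]
  have := exists_immersion_of_trails (G := G) (t := certEntry c 0 0) (Q := certEntry c 0 1)
    (fun i => ⟨f (certEntry c 1 i), hlab i i.2⟩) ?_ (fun r => certTrail L c r)
    (fun r => (⟨certEntry c 2 r, (hc.ends_lt r r.2).1.trans (hc.ends_lt r r.2).2⟩,
      ⟨certEntry c 3 r, (hc.ends_lt r r.2).2⟩)) ?_ ?_ ?_ ?_ ?_ ?_ ?_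
  · convert this using 4
    rw [certTrails, List.ofFn_eq_map, ← List.map_coe_finRange_eq_range, List.map_map]
    rfl
  · intro i j hij
    have h : f (certEntry c 1 i) = f (certEntry c 1 j) := congrArg Subtype.val hij
    have h' : certEntry c 1 i = certEntry c 1 j := by rw [← hlab' i i.2, ← hlab' j j.2, h]
    by_contra hne
    rcases Fin.lt_or_lt_of_ne hne with hlt | hlt
    · exact hc.label_ne j j.2 i hlt h'.symm
    · exact hc.label_ne i i.2 j hlt h'
  · intro r r' h
    simp only [Prod.mk.injEq, Fin.mk.injEq] at h
    by_contra hne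
    rcases Fin.lt_or_lt_of_ne hne with hlt | hlt
    · exact hc.ends_ne r' r'.2 r hlt ⟨h.1.symm, h.2.symm⟩
    · exact hc.ends_ne r r.2 r' hlt h
  · exact fun r => (hc.ends_lt r r.2).1
  · intro i j hij
    obtain ⟨r, hr, h₁, h₂⟩ := hc.ends_surj j j.2 i hij
    exact ⟨⟨r, hr⟩, Prod.ext (Fin.ext h₁) (Fin.ext h₂)⟩
  · intro r
    obtain ⟨h₁, h₂, h₃⟩ := hc.isPiece r r.2
    have w₁ := h₁.isWalkFromTo hf (hlab _ ((hc.ends_lt r r.2).1.trans (hc.ends_lt r r.2).2))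
    have w₂ := h₂.isWalkFromTo hf w₁.right_mem
    exact (w₁.append w₂).append (h₃.isWalkFromTo hf w₂.right_mem)
  · intro r
    have := r.2
    rw [certTrail, List.nodup_append', List.nodup_append', List.disjoint_append_left]
    exact ⟨⟨nodup_piece hL _, nodup_piece hL _, hdisj _ (by omega) _ (by omega) (by omega)⟩,
      nodup_piece hL _, hdisj _ (by omega) _ (by omega) (by omega),
      hdisj _ (by omega) _ (by omega) (by omega)⟩
  · intro r r' hne
    have := r.2
    have := r'.2
    have : r.1 ≠ r'.1 := fun h => hne (Fin.ext h)
    simp only [certTrail, List.disjoint_append_left, List.disjoint_append_right]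
    refine ⟨⟨⟨⟨?_, ?_⟩, ?_⟩, ⟨⟨?_, ?_⟩, ?_⟩⟩, ⟨⟨?_, ?_⟩, ?_⟩⟩ <;>
      exact hdisj _ (by omega) _ (by omega) (by omega)
  · intro r
    have := hc.even r r.2
    simp only [pieceParity_trailData] at this
    rw [Nat.even_iff, certTrail, List.length_append, List.length_append]
    omega

end Soundness

/-! ### Existence of certificates -/

section Completeness

variable {α β : Type*} {G : Graph α β}

/-- The number of trails determines the order of the clique; this is how a program for all `t`
learns `t`. -/
theorem Immersion.IsTrailList.two_mul_length {n : ℕ} {φ : Immersion (cliqueGraph n) G}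
    {L : List (List β)} (h : φ.IsTrailList L) : 2 * L.length = n * (n - 1) := by
  classical
  have h₁ : L.length = (Finset.univ.image φ.trail).card := by
    rw [← List.toFinset_card_of_nodup h.1]
    congr 1
    ext T
    simp [h.2]
  have h₂ : Fintype.card E(cliqueGraph n) = n.choose 2 := by
    have := SimpleGraph.card_edgeFinset_top_eq_card_choose_two (V := Fin n)
    rw [Fintype.card_fin] at this
    rw [← this, SimpleGraph.edgeFinset, Set.toFinset_card]
    exact Fintype.card_congr (Equiv.refl _)
  rw [h₁, Finset.card_image_of_injective _ φ.trail_injective, Finset.card_univ, h₂,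
    Nat.choose_two_right, Nat.mul_div_cancel' (Nat.even_mul_pred_self n).two_dvd]

theorem cliqueGraph_exists_isLink {n : ℕ} (e : E(cliqueGraph n)) :
    ∃ u v : V(cliqueGraph n), u ≠ v ∧ (cliqueGraph n).IsLink e u v := by
  obtain ⟨u, v, h⟩ := (Graph.edge_mem_iff_exists_isLink _ _).1 e.2
  exact ⟨⟨u, h.left_mem⟩, ⟨v, h.right_mem⟩, fun h' => (cliqueGraph_isLink.1 h).2
    (congrArg Subtype.val h'), h⟩

theorem Immersion.IsTrailList.exists_ends {n : ℕ} {φ : Immersion (cliqueGraph n) G}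
    {L : List (List β)} (h : φ.IsTrailList L) {T : List β} (hT : T ∈ L) :
    ∃ u v : α, u ≠ v ∧ IsTrailWithEnds G T u v := by
  obtain ⟨e, rfl⟩ := (h.2 T).1 hT
  obtain ⟨u, v, huv, hl⟩ := cliqueGraph_exists_isLink e
  exact ⟨φ.vert u, φ.vert v, fun h => huv (φ.vert_injective (Subtype.ext h)),
    φ.trail_ends e u v hl⟩

theorem Immersion.IsTrailList.nodup_flatten {n : ℕ} {φ : Immersion (cliqueGraph n) G}
    {L : List (List β)} (h : φ.IsTrailList L) : L.flatten.Nodup := by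
  refine List.nodup_flatten.2 ⟨fun T hT => ?_, h.1.imp_of_mem fun {T T'} hT hT' hne => ?_⟩
  · obtain ⟨u, v, -, h⟩ := h.exists_ends hT
    exact h.nodup
  · obtain ⟨e, rfl⟩ := (h.2 _).1 hT
    obtain ⟨e', rfl⟩ := (h.2 _).1 hT'
    exact φ.edge_disjoint _ _ fun h => hne (congrArg _ h)

/-- The pieces that join the branch vertices of an immersion of a complete graph. -/
theorem Immersion.IsTrailList.exists_pieces {n : ℕ} {φ : Immersion (cliqueGraph n) G}
    {L : List (List β)} (h : φ.IsTrailList L) {f : ℕ → α}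
    (hf : ∀ (k : ℕ) (hk : k < L.length), IsWalkFromTo G (f (2 * k)) L[k] (f (2 * k + 1)))
    (hn : 2 ≤ n) :
    ∃ (label : Fin n → ℕ) (z : Fin n → Fin n → ℕ) (s : Fin n → Fin n → ZMod 2),
      Function.Injective label ∧
      (∀ u, label u < 2 * L.length ∧ (trailData f L).getD (label u) 0 = label u) ∧
      (∀ u v, s u v = s v u) ∧ (∀ u, s u u = 0) ∧
      (∀ u v, IsPiece (trailData f L) (z u v) (label u) (label v)) ∧
      (∀ u v, (pieceParity (trailData f L) (z u v) : ZMod 2) = s u v) ∧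
      ∀ u v u' v', z u v / 2 = z u' v' / 2 → (u ≠ v → s(u, v) ≠ s(u', v')) → z u v / 2 = L.length := by
  have hlink : ∀ u v : Fin n, u ≠ v → s(u, v) ∈ E(cliqueGraph n) := fun u v huv =>
    mem_cliqueGraph_edgeSet.2 huv
  let vert : Fin n → α := fun u => φ.vert ⟨u, trivial⟩
  have hvert : Function.Injective vert := fun u v huv =>
    congrArg Subtype.val (φ.vert_injective (Subtype.ext huv))
  -- The existential over `k` stands outside the condition `u ≠ v` so that the index becomes a total
  -- function, with a dummy value on the diagonal.
  have hidx : ∀ u v : Fin n, ∃ k, ∀ huv : u ≠ v, ∃ hk : k < L.length,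
      L[k] = φ.trail ⟨s(u, v), hlink u v huv⟩ := by
    intro u v
    by_cases huv : u = v
    · exact ⟨0, fun h => absurd huv h⟩
    · obtain ⟨k, hk, hkL⟩ := List.mem_iff_getElem.1
        ((h.2 (φ.trail ⟨s(u, v), hlink u v huv⟩)).2 ⟨_, rfl⟩)
      exact ⟨k, fun _ => ⟨hk, hkL⟩⟩
  choose idx hidx using hidx
  have hends : ∀ u v : Fin n, u ≠ v → (f (2 * idx u v) = vert u ∧ f (2 * idx u v + 1) = vert v) ∨
      (f (2 * idx u v) = vert v ∧ f (2 * idx u v + 1) = vert u) := by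
    intro u v huv
    obtain ⟨hk, hkL⟩ := hidx u v huv
    have h₁ := hf _ hk
    have h₂ := (φ.trail_ends ⟨s(u, v), hlink u v huv⟩ ⟨u, trivial⟩ ⟨v, trivial⟩
      (cliqueGraph_isLink.2 ⟨rfl, huv⟩)).ends
    rw [← hkL] at h₂
    exact h₁.ends_eq_or_eq h₂ fun h => huv (hvert h)
  -- The trail is taken forwards or backwards according to which of its recorded ends is `u`; on the
  -- diagonal the empty piece is used.
  have hz : ∀ u v : Fin n, ∃ z, (u ≠ v → z < 2 * L.length ∧ z / 2 = idx u v ∧ f z = vert u ∧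
      f (4 * (z / 2) + 1 - z) = vert v) ∧ (u = v → z = 2 * L.length) := by
    intro u v
    by_cases huv : u = v
    · exact ⟨2 * L.length, fun h => absurd huv h, fun _ => rfl⟩
    · obtain ⟨hk, -⟩ := hidx u v huv
      rcases hends u v huv with ⟨h₁, h₂⟩ | ⟨h₁, h₂⟩
      · refine ⟨2 * idx u v, fun _ => ⟨by omega, by omega, h₁, ?_⟩, fun h => absurd h huv⟩
        rwa [show 4 * (2 * idx u v / 2) + 1 - 2 * idx u v = 2 * idx u v + 1 by omega]
      · refine ⟨2 * idx u v + 1, fun _ => ⟨by omega, by omega, h₂, ?_⟩, fun h => absurd h huv⟩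
        rwa [show 4 * ((2 * idx u v + 1) / 2) + 1 - (2 * idx u v + 1) = 2 * idx u v by omega]
  choose z hz hz₀ using hz
  -- Here `2 ≤ n` is needed: a vertex has a label only if it is an end of some trail.
  have hsurj : ∀ u, ∃ e < 2 * L.length, f e = vert u := fun u => by
    obtain ⟨v, hv⟩ := @exists_ne _ (Fin.nontrivial_iff_two_le.2 hn) u
    exact ⟨z u v, (hz u v hv.symm).1, (hz u v hv.symm).2.2.1⟩
  have hlab : ∀ u, f (firstIndex f (vert u)) = vert u := fun u => by
    obtain ⟨e, -, he⟩ := hsurj u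
    rw [← he]
    exact apply_firstIndex f e
  have hlab_lt : ∀ u, firstIndex f (vert u) < 2 * L.length := fun u => by
    obtain ⟨e, he, he'⟩ := hsurj u
    rw [← he']
    exact (firstIndex_le f e).trans_lt he
  have hM : (trailData f L).length / 3 = L.length := by
    rw [length_trailData, Nat.mul_div_cancel_left _ (by norm_num)]
  refine ⟨fun u => firstIndex f (vert u), z, fun u v => if huv : u = v then 0 else
    (φ.trail ⟨s(u, v), hlink u v huv⟩).length, fun u v huv => ?_, fun u => ⟨hlab_lt u, ?_⟩,
    fun u v => ?_, fun u => ?_, fun u v => ?_, fun u v => ?_, fun u v u' v' hzz hne => ?_⟩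
  · exact hvert (by rw [← hlab u, ← hlab v]; exact congrArg f huv)
  · rw [trailData_getD_of_lt (hlab_lt u), hlab]
  · by_cases huv : u = v
    · simp [huv]
    · simp only [huv, Ne.symm huv, dite_false]
      congr 4
      exact Sym2.eq_swap
  · simp
  · by_cases huv : u = v
    · exact .inr ⟨by rw [hz₀ u v huv, hM], by rw [huv]⟩
    · obtain ⟨h₁, -, h₂, h₃⟩ := hz u v huv
      refine .inl ⟨by rwa [hM], ?_, ?_⟩
      · rw [trailData_getD_of_lt h₁, h₂]
      · rw [trailData_getD_of_lt (by omega), h₃]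
  · rw [pieceParity_trailData, ZMod.natCast_mod]
    by_cases huv : u = v
    · have : L.length ≤ z u v / 2 := by
        have := hz₀ u v huv
        omega
      rw [piece_eq_nil this]
      simp [huv]
    · obtain ⟨hk, hkL⟩ := hidx u v huv
      simp only [huv, dite_false]
      have h₁ : (piece L (z u v)).length = (L.getD (z u v / 2) []).length := by
        rw [piece]
        split <;> simp
      rw [h₁, (hz u v huv).2.1, List.getD_eq_getElem _ _ hk, hkL]
  · by_cases huv : u = v
    · have := hz₀ u v huv
      omega
    · by_cases huv' : u' = v'
      · have := hz₀ u' v' huv'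
        omega
      · rw [(hz u v huv).2.1, (hz u' v' huv').2.1] at hzz
        obtain ⟨hk, hkL⟩ := hidx u v huv
        obtain ⟨hk', hkL'⟩ := hidx u' v' huv'
        have : φ.trail ⟨s(u, v), hlink u v huv⟩ = φ.trail ⟨s(u', v'), hlink u' v' huv'⟩ := by
          rw [← hkL, ← hkL']
          congr 1
        exact absurd (congrArg Subtype.val (φ.trail_injective this)) (hne huv)

theorem List.getD_ofFn_of_lt {n : ℕ} (g : Fin n → ℕ) {i : ℕ} (hi : i < n) :
    (List.ofFn g).getD i 0 = g ⟨i, hi⟩ := by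
  simp [hi]

/-- The ends of the `a`-th edge of the path that joins `S p.1` to `S p.2` in an even linkage. -/
def pathEdge {V : Type*} {t : ℕ} (S : Fin t → V) (nb : Fin t → Fin t → V) (p : Fin t × Fin t)
    (a : ℕ) : V × V :=
  if a = 0 then (S p.1, nb p.1 p.2) else if a = 1 then (nb p.1 p.2, nb p.2 p.1)
  else (nb p.2 p.1, S p.2)

/-- The paths of an even linkage use different edges. -/
theorem EvenLinkage.sym2_ne {V : Type*} {s : V → V → ZMod 2} {t : ℕ}
    {S : Fin t → V} (hS : Function.Injective S) {nb : Fin t → Fin t → V}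
    {P : Finset (Fin t × Fin t)} (hP : ∀ p ∈ P, p.1 < p.2) (h : EvenLinkage s S nb P)
    {p p' : Fin t × Fin t} (hr : p ∈ P) (hr' : p' ∈ P) {a a' : ℕ} (ha : a < 3) (ha' : a' < 3)
    (hne : p = p' → a ≠ a') (hee : (pathEdge S nb p a).1 ≠ (pathEdge S nb p a).2) :
    s((pathEdge S nb p a).1, (pathEdge S nb p a).2) ≠
      s((pathEdge S nb p' a').1, (pathEdge S nb p' a').2) := by
  obtain ⟨i, j⟩ := p
  obtain ⟨i', j'⟩ := p'
  have hij : i < j := hP _ hr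
  have hij' : i' < j' := hP _ hr'
  -- An outer edge has exactly one end among the `S k`, which identifies `a`; then the other end
  -- identifies `b`. Middle edges have no end among the `S k`, whence `mid`.
  have arm : ∀ a b a' b', ((a, b) ∈ P ∨ (b, a) ∈ P) → ((a', b') ∈ P ∨ (b', a') ∈ P) →
      s(S a, nb a b) = s(S a', nb a' b') → a = a' ∧ b = b' := by
    intro a b a' b' hab hab' h'
    rw [Sym2.eq_iff] at h'
    rcases h' with ⟨h₁, h₂⟩ | ⟨h₁, h₂⟩
    · obtain rfl := hS h₁
      by_contra hb
      exact h.nb_ne a b b' hab hab' (fun h => hb ⟨rfl, h⟩) h₂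
    · exact absurd h₂ (h.notMem a b hab a')
  have mid : ∀ a b c d, ((a, b) ∈ P ∨ (b, a) ∈ P) → (c, d) ∈ P →
      s(S a, nb a b) ≠ s(nb c d, nb d c) := by
    intro a b c d hab hcd h'
    rw [Sym2.eq_iff] at h'
    rcases h' with ⟨h₁, -⟩ | ⟨h₁, -⟩
    · exact h.notMem c d (.inl hcd) a h₁.symm
    · exact h.notMem d c (.inr hcd) a h₁.symm
  have h₃ : a = 0 ∨ a = 1 ∨ a = 2 := by omega
  have h₃' : a' = 0 ∨ a' = 1 ∨ a' = 2 := by omega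
  rcases h₃ with rfl | rfl | rfl <;> rcases h₃' with rfl | rfl | rfl <;>
    simp only [pathEdge, if_true, if_false, one_ne_zero, OfNat.ofNat_ne_zero,
      OfNat.ofNat_ne_one] at hee ⊢ <;> intro h'
  · obtain ⟨rfl, rfl⟩ := arm _ _ _ _ (.inl hr) (.inl hr') h'
    exact hne rfl rfl
  · exact mid _ _ _ _ (.inl hr) hr' h'
  -- A first edge equal to a last edge would give `i = j'` and `j = i'`, against `i < j` and `i' <
  -- j'`.
  · rw [Sym2.eq_swap (a := nb j' i')] at h'
    obtain ⟨rfl, rfl⟩ := arm _ _ _ _ (.inl hr) (.inr hr') h'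
    exact hij.not_gt hij'
  · exact mid _ _ _ _ (.inl hr') hr h'.symm
  · exact h.middle_ne _ hr _ hr' (fun h => hne h rfl) hee h'
  · rw [Sym2.eq_swap (a := nb j' i')] at h'
    exact mid _ _ _ _ (.inr hr') hr h'.symm
  · rw [Sym2.eq_swap (a := nb j i)] at h'
    obtain ⟨rfl, rfl⟩ := arm _ _ _ _ (.inr hr) (.inl hr') h'
    exact hij.not_gt hij'
  · rw [Sym2.eq_swap (a := nb j i)] at h'
    exact mid _ _ _ _ (.inr hr) hr' h'
  · rw [Sym2.eq_swap (a := nb j i), Sym2.eq_swap (a := nb j' i')] at h'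
    obtain ⟨rfl, rfl⟩ := arm _ _ _ _ (.inr hr) (.inr hr') h'
    exact hne rfl rfl

/-- The branch trails of an immersion of `K_{70t+71}` have a certificate. -/
theorem Immersion.IsTrailList.exists_isCert {t : ℕ} {φ : Immersion (cliqueGraph (70 * t + 71)) G}
    {L : List (List β)} (h : φ.IsTrailList L) {f : ℕ → α}
    (hf : ∀ (k : ℕ) (hk : k < L.length), IsWalkFromTo G (f (2 * k)) L[k] (f (2 * k + 1))) :
    ∃ c, IsCert (trailData f L) c := by
  obtain ⟨label, z, s, hlabel, hlabel', hs, hs₀, hpiece, hparity, hz⟩ :=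
    h.exists_pieces hf (by omega)
  obtain ⟨S, nb, hS, hlink⟩ := exists_evenLinkage hs hs₀ (t := t) (by simp)
  set P : Finset (Fin t × Fin t) := Finset.univ.filter fun p => p.1 < p.2 with hP
  have hP' : ∀ p ∈ P, p.1 < p.2 := by simp [hP]
  obtain ⟨Q, pr, hprP, hinj, hprsurj⟩ : ∃ (Q : ℕ) (pr : Fin Q → Fin t × Fin t),
      (∀ r, pr r ∈ P) ∧ Function.Injective pr ∧ ∀ p ∈ P, ∃ r, pr r = p :=
    ⟨P.card, fun r => P.equivFin.symm r, fun r => (P.equivFin.symm r).2,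
      fun r r' h => P.equivFin.symm.injective (Subtype.ext h),
      fun p hp => ⟨P.equivFin ⟨p, hp⟩, by simp⟩⟩
  have hM : (trailData f L).length / 3 = L.length := by
    rw [length_trailData, Nat.mul_div_cancel_left _ (by norm_num)]
  -- List `4` has at position `3 * r + a` the piece for the `a`-th edge of path `r`; list `5` has at
  -- `2 * r` and `2 * r + 1` the labels of its two inner vertices.
  let c : List (List ℕ) := [[t, Q], List.ofFn fun i => label (S i),
    List.ofFn fun r => ((pr r).1 : ℕ), List.ofFn fun r => ((pr r).2 : ℕ),
    List.ofFn fun q : Fin (3 * Q) =>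
      let e := pathEdge S nb (pr ⟨q / 3, by omega⟩) (q % 3)
      z e.1 e.2,
    List.ofFn fun q : Fin (2 * Q) =>
      let p := pr ⟨q / 2, by omega⟩
      if (q : ℕ) % 2 = 0 then label (nb p.1 p.2) else label (nb p.2 p.1)]
  have c₁ : ∀ i (hi : i < t), certEntry c 1 i = label (S ⟨i, hi⟩) := fun i hi =>
    List.getD_ofFn_of_lt _ hi
  have c₂ : ∀ r (hr : r < Q), certEntry c 2 r = (pr ⟨r, hr⟩).1 := fun r hr =>
    List.getD_ofFn_of_lt _ hr
  have c₃ : ∀ r (hr : r < Q), certEntry c 3 r = (pr ⟨r, hr⟩).2 := fun r hr =>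
    List.getD_ofFn_of_lt _ hr
  have c₄ : ∀ r (hr : r < Q) a (_ : a < 3), certEntry c 4 (3 * r + a) =
      z (pathEdge S nb (pr ⟨r, hr⟩) a).1 (pathEdge S nb (pr ⟨r, hr⟩) a).2 := by
    intro r hr a ha
    have e₁ : (3 * r + a) / 3 = r := by omega
    have e₂ : (3 * r + a) % 3 = a := by omega
    refine (List.getD_ofFn_of_lt _ (show 3 * r + a < 3 * Q by omega)).trans ?_
    simp only [e₁, e₂]
  have c₄' : ∀ r (hr : r < Q), certEntry c 4 (3 * r) =
      z (pathEdge S nb (pr ⟨r, hr⟩) 0).1 (pathEdge S nb (pr ⟨r, hr⟩) 0).2 :=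
    fun r hr => c₄ r hr 0 (by norm_num)
  have c₅ : ∀ r (hr : r < Q), certEntry c 5 (2 * r) =
      label (nb (pr ⟨r, hr⟩).1 (pr ⟨r, hr⟩).2) := by
    intro r hr
    have e₁ : 2 * r / 2 = r := by omega
    have e₂ : 2 * r % 2 = 0 := by omega
    refine (List.getD_ofFn_of_lt _ (show 2 * r < 2 * Q by omega)).trans ?_
    simp only [e₁, e₂, if_true]
  have c₅' : ∀ r (hr : r < Q), certEntry c 5 (2 * r + 1) =
      label (nb (pr ⟨r, hr⟩).2 (pr ⟨r, hr⟩).1) := by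
    intro r hr
    have e₁ : (2 * r + 1) / 2 = r := by omega
    have e₂ : (2 * r + 1) % 2 = 1 := by omega
    refine (List.getD_ofFn_of_lt _ (show 2 * r + 1 < 2 * Q by omega)).trans ?_
    simp only [e₁, e₂, one_ne_zero, if_false]
  refine ⟨c, ?_, fun i hi => ?_, fun i hi j hj => ?_, fun r hr => ?_, fun r hr r' hr' => ?_,
    fun j hj i hi => ?_, fun r hr => ?_, fun r hr => ?_, fun q hq q' hq' => ?_⟩
  · rw [hM, h.two_mul_length]
    rfl
  · change i < t at hi
    rw [c₁ i hi, hM]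
    exact hlabel' _
  · change i < t at hi
    rw [c₁ i hi, c₁ j (hj.trans hi)]
    exact fun h => hj.ne' (Fin.mk.inj (hS (hlabel h)))
  · change r < Q at hr
    rw [c₂ r hr, c₃ r hr]
    exact ⟨hP' _ (hprP _), (pr ⟨r, hr⟩).2.2⟩
  · change r < Q at hr
    rw [c₂ r hr, c₃ r hr, c₂ r' (hr'.trans hr), c₃ r' (hr'.trans hr)]
    rintro ⟨h₁, h₂⟩
    exact hr'.ne' (Fin.mk.inj (hinj (Prod.ext (Fin.ext h₁) (Fin.ext h₂))))
  · change j < t at hj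
    obtain ⟨r, hr⟩ := hprsurj (⟨i, hi.trans hj⟩, ⟨j, hj⟩) (by simpa [hP] using hi)
    refine ⟨r, r.2, ?_, ?_⟩
    · rw [c₂ r r.2]
      simp [hr]
    · rw [c₃ r r.2]
      simp [hr]
  · change r < Q at hr
    rw [c₄' r hr, c₄ r hr 1 (by norm_num),
      c₄ r hr 2 (by norm_num), c₂ r hr, c₃ r hr, c₅ r hr, c₅' r hr, c₁ _ (Fin.is_lt _),
      c₁ _ (Fin.is_lt _)]
    exact ⟨hpiece _ _, hpiece _ _, hpiece _ _⟩
  · change r < Q at hr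
    rw [c₄' r hr, c₄ r hr 1 (by norm_num),
      c₄ r hr 2 (by norm_num), ← Nat.even_iff, ← ZMod.natCast_eq_zero_iff_even]
    push_cast
    rw [hparity, hparity, hparity]
    exact hlink.even _ (hprP _)
  · change q < 3 * Q at hq
    rw [← Nat.div_add_mod q 3, ← Nat.div_add_mod q' 3, c₄ (q / 3) (by omega) _ (by omega),
      c₄ (q' / 3) (by omega) _ (by omega), hM]
    intro hzz
    set p := pr ⟨q / 3, by omega⟩ with hp
    set p' := pr ⟨q' / 3, by omega⟩ with hp'
    -- Two pieces from the same trail would come from the same clique edge, which the linkage uses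
    -- only once; the exception is a degenerate middle step, whose piece is empty.
    refine hz _ _ _ _ hzz fun hee => hlink.sym2_ne hS hP' (hprP _) (hprP _) (by omega) (by omega)
      (fun h => ?_) hee
    have := Fin.mk.inj (hinj h)
    omega

end Completeness

/-! ### Certificates can be checked by a primitive recursive function -/

section Primrec

variable {α : Type} [Primcodable α]

/-- A bounded quantifier is a quantifier over the members of `List.range`, for which closure is
known. -/
theorem PrimrecPred.forall_lt_of_primrec {p : α → ℕ → Prop} {f : α → ℕ} (hf : Primrec f)
    (hp : PrimrecPred fun x : α × ℕ => p x.1 x.2) : PrimrecPred fun a => ∀ i < f a, p a i := by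
  have h : PrimrecRel fun (i : ℕ) (a : α) => p a i :=
    hp.comp (Primrec.pair Primrec.snd Primrec.fst)
  exact (h.forall_mem_list.comp (Primrec.list_range.comp hf) .id).of_eq fun a => by
    simp [List.mem_range]

theorem PrimrecPred.exists_lt_of_primrec {p : α → ℕ → Prop} {f : α → ℕ} (hf : Primrec f)
    (hp : PrimrecPred fun x : α × ℕ => p x.1 x.2) : PrimrecPred fun a => ∃ i < f a, p a i := by
  have h : PrimrecRel fun (i : ℕ) (a : α) => p a i :=
    hp.comp (Primrec.pair Primrec.snd Primrec.fst)
  exact (h.exists_mem_list.comp (Primrec.list_range.comp hf) .id).of_eq fun a => by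
    simp [List.mem_range]

theorem Primrec.certEntry_comp {c : α → List (List ℕ)} {n i : α → ℕ} (hc : Primrec c)
    (hn : Primrec n) (hi : Primrec i) : Primrec fun a => certEntry (c a) (n a) (i a) :=
  (Primrec.list_getD 0).comp ((Primrec.list_getD []).comp hc hn) hi

theorem PrimrecPred.imp {p q : α → Prop} (hp : PrimrecPred p) (hq : PrimrecPred q) :
    PrimrecPred fun a => p a → q a :=
  (hp.not.or hq).of_eq fun _ => imp_iff_not_or.symm

theorem PrimrecPred.isPiece {D : α → List ℕ} {z x y : α → ℕ} (hD : Primrec D) (hz : Primrec z)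
    (hx : Primrec x) (hy : Primrec y) : PrimrecPred fun a => IsPiece (D a) (z a) (x a) (y a) := by
  have hM : Primrec fun a => 2 * ((D a).length / 3) :=
    Primrec.nat_mul.comp (.const 2)
      (Primrec.nat_div.comp (Primrec.list_length.comp hD) (.const 3))
  refine .or (.and (Primrec.nat_lt.comp hz hM) (.and ?_ ?_))
    (.and (Primrec.eq.comp hz hM) (Primrec.eq.comp hx hy))
  · exact Primrec.eq.comp ((Primrec.list_getD 0).comp hD hz) hx
  · exact Primrec.eq.comp ((Primrec.list_getD 0).comp hD (Primrec.nat_sub.comp (Primrec.nat_add.comp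
      (Primrec.nat_mul.comp (.const 4) (Primrec.nat_div.comp hz (.const 2))) (.const 1)) hz)) hy

theorem Primrec.pieceParity_comp {D : α → List ℕ} {z : α → ℕ} (hD : Primrec D) (hz : Primrec z) :
    Primrec fun a => pieceParity (D a) (z a) :=
  (Primrec.list_getD 0).comp hD (Primrec.nat_add.comp (Primrec.nat_mul.comp (.const 2)
    (Primrec.nat_div.comp (Primrec.list_length.comp hD) (.const 3)))
      (Primrec.nat_div.comp hz (.const 2)))

theorem PrimrecPred.isCert {D : α → List ℕ} {c : α → List (List ℕ)} (hD : Primrec D)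
    (hc : Primrec c) : PrimrecPred fun a => IsCert (D a) (c a) := by
  -- Each bounded quantifier pairs the context with a new variable, so these facts are stated for
  -- any context `γ` with a projection `p` to `α`.
  have entry : ∀ {γ : Type} [Primcodable γ] (p : γ → α) (n : ℕ) (i : γ → ℕ), Primrec p →
      Primrec i → Primrec fun a => certEntry (c (p a)) n (i a) := fun p n i hp hi =>
    .certEntry_comp (hc.comp hp) (.const n) hi
  have entry0 : ∀ {γ : Type} [Primcodable γ] (p : γ → α) (i : ℕ), Primrec p →
      Primrec fun a => certEntry (c (p a)) 0 i := fun p i hp => entry p 0 _ hp (.const i)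
  have hM : ∀ {γ : Type} [Primcodable γ] (p : γ → α), Primrec p →
      Primrec fun a => (D (p a)).length / 3 := fun p hp =>
    Primrec.nat_div.comp (Primrec.list_length.comp (hD.comp hp)) (.const 3)
  have lin : ∀ {γ : Type} [Primcodable γ] (a b : ℕ) (i : γ → ℕ), Primrec i →
      Primrec fun x => a * i x + b := fun a b i hi =>
    Primrec.nat_add.comp (Primrec.nat_mul.comp (.const a) hi) (.const b)
  have lin0 : ∀ {γ : Type} [Primcodable γ] (a : ℕ) (i : γ → ℕ), Primrec i →
      Primrec fun x => a * i x := fun a i hi => Primrec.nat_mul.comp (.const a) hi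
  refine PrimrecPred.of_eq (.and ?_ (.and ?_ (.and ?_ (.and ?_ (.and ?_ (.and ?_ (.and ?_ (.and ?_
    ?_)))))))) fun a => ⟨fun ⟨h₁, h₂, h₃, h₄, h₅, h₆, h₇, h₈, h₉⟩ =>
      IsCert.mk h₁ h₂ h₃ h₄ h₅ h₆ h₇ h₈ h₉,
      fun ⟨h₁, h₂, h₃, h₄, h₅, h₆, h₇, h₈, h₉⟩ => ⟨h₁, h₂, h₃, h₄, h₅, h₆, h₇, h₈, h₉⟩⟩
  · exact Primrec.eq.comp (Primrec.nat_mul.comp (lin _ _ _ (entry0 _ _ .id))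
      (lin _ _ _ (entry0 _ _ .id))) (lin0 _ _ (hM _ .id))
  · refine .forall_lt_of_primrec (entry0 _ _ .id) (.and ?_ ?_)
    · exact Primrec.nat_lt.comp (entry _ _ _ .fst .snd) (lin0 _ _ (hM _ .fst))
    · exact Primrec.eq.comp ((Primrec.list_getD 0).comp (hD.comp .fst) (entry _ _ _ .fst .snd))
        (entry _ _ _ .fst .snd)
  · refine .forall_lt_of_primrec (entry0 _ _ .id) (.forall_lt_of_primrec .snd (.not ?_))
    exact Primrec.eq.comp (entry _ _ _ (Primrec.fst.comp .fst) (Primrec.snd.comp .fst))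
      (entry _ _ _ (Primrec.fst.comp .fst) .snd)
  · refine .forall_lt_of_primrec (entry0 _ _ .id) (.and ?_ ?_)
    · exact Primrec.nat_lt.comp (entry _ _ _ .fst .snd) (entry _ _ _ .fst .snd)
    · exact Primrec.nat_lt.comp (entry _ _ _ .fst .snd) (entry0 _ _ .fst)
  · refine .forall_lt_of_primrec (entry0 _ _ .id) (.forall_lt_of_primrec .snd (.not (.and ?_ ?_)))
    · exact Primrec.eq.comp (entry _ _ _ (Primrec.fst.comp .fst) (Primrec.snd.comp .fst))
        (entry _ _ _ (Primrec.fst.comp .fst) .snd)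
    · exact Primrec.eq.comp (entry _ _ _ (Primrec.fst.comp .fst) (Primrec.snd.comp .fst))
        (entry _ _ _ (Primrec.fst.comp .fst) .snd)
  · refine .forall_lt_of_primrec (entry0 _ _ .id) (.forall_lt_of_primrec .snd
      (.exists_lt_of_primrec (entry0 _ _ (Primrec.fst.comp .fst)) (.and ?_ ?_)))
    · exact Primrec.eq.comp (entry _ _ _ (Primrec.fst.comp (Primrec.fst.comp .fst)) .snd)
        (Primrec.snd.comp .fst)
    · exact Primrec.eq.comp (entry _ _ _ (Primrec.fst.comp (Primrec.fst.comp .fst)) .snd)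
        (Primrec.snd.comp (Primrec.fst.comp .fst))
  · refine .forall_lt_of_primrec (entry0 _ _ .id) (.and ?_ (.and ?_ ?_))
    · exact .isPiece (hD.comp .fst) (entry _ _ _ .fst (lin0 _ _ .snd))
        (entry _ _ _ .fst (entry _ _ _ .fst .snd)) (entry _ _ _ .fst (lin0 _ _ .snd))
    · exact .isPiece (hD.comp .fst) (entry _ _ _ .fst (lin _ _ _ .snd))
        (entry _ _ _ .fst (lin0 _ _ .snd)) (entry _ _ _ .fst (lin _ _ _ .snd))
    · exact .isPiece (hD.comp .fst) (entry _ _ _ .fst (lin _ _ _ .snd))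
        (entry _ _ _ .fst (lin _ _ _ .snd)) (entry _ _ _ .fst (entry _ _ _ .fst .snd))
  · refine .forall_lt_of_primrec (entry0 _ _ .id) (Primrec.eq.comp (Primrec.nat_mod.comp
      (Primrec.nat_add.comp (Primrec.nat_add.comp ?_ ?_) ?_) (.const 2)) (.const 0))
    · exact .pieceParity_comp (hD.comp .fst) (entry _ _ _ .fst (lin0 _ _ .snd))
    · exact .pieceParity_comp (hD.comp .fst) (entry _ _ _ .fst (lin _ _ _ .snd))
    · exact .pieceParity_comp (hD.comp .fst) (entry _ _ _ .fst (lin _ _ _ .snd))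
  · refine .forall_lt_of_primrec (lin0 _ _ (entry0 _ _ .id)) (.forall_lt_of_primrec .snd
      (.imp (Primrec.eq.comp (Primrec.nat_div.comp ?_ (.const 2))
      (Primrec.nat_div.comp ?_ (.const 2))) (Primrec.eq.comp (Primrec.nat_div.comp ?_ (.const 2))
        (hM _ (Primrec.fst.comp .fst)))))
    · exact entry _ _ _ (Primrec.fst.comp .fst) (Primrec.snd.comp .fst)
    · exact entry _ _ _ (Primrec.fst.comp .fst) .snd
    · exact entry _ _ _ (Primrec.fst.comp .fst) (Primrec.snd.comp .fst)

end Primrec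

/-- The value is `0` if and only if `y` is the code of a certificate for the list with code `x`. -/
noncomputable def checkCert (x y : ℕ) : ℕ :=
  open scoped Classical in
  if IsCert (Denumerable.ofNat (List ℕ) x) (Denumerable.ofNat (List (List ℕ)) y) then 0 else 1

theorem checkCert_eq_zero {x y : ℕ} : checkCert x y = 0 ↔
    IsCert (Denumerable.ofNat (List ℕ) x) (Denumerable.ofNat (List (List ℕ)) y) := by
  rw [checkCert]
  split <;> simp_all

theorem primrec_checkCert : Primrec₂ checkCert := by
  classical
  exact Primrec.ite (PrimrecPred.isCert ((Primrec.ofNat _).comp .fst) ((Primrec.ofNat _).comp .snd))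
    (.const 0) (.const 1)

/-- The `i`-th entry of the `n`-th list of the certificate with code `y`. -/
def codeEntry (n y i : ℕ) : ℕ := certEntry (Denumerable.ofNat (List (List ℕ)) y) n i

theorem primrec_codeEntry (n : ℕ) : Primrec₂ (codeEntry n) :=
  Primrec.certEntry_comp ((Primrec.ofNat _).comp .fst) (.const n) .snd

/-! ### The ends, parities and labels of the trails -/

/-- The programs of the list, one after the other. -/
abbrev RamProg.block (l : List RamProg) : RamProg := l.foldr .seq .skip

/-- The states `s` and `s'` differ only where `P` may write. -/
def RamProg.Frame (P : RamProg) (s s' : RamState) : Prop :=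
  (∀ r, ¬ P.WritesReg r → s'.reg r = s.reg r) ∧ ∀ a, ¬ P.WritesArr a → s'.arr a = s.arr a

/-- A loop with `n` rounds, of at most `b` steps each, and with the invariant `I`. -/
theorem Wp.while_frame {c : RamExpr} {p : RamProg} {s : RamState} (I : ℕ → RamState → Prop)
    (n b : ℕ)
    (hbody : ∀ j < n, ∀ s₁, p.Frame s s₁ → I j s₁ →
      c.eval s₁ ≠ 0 ∧ Wp p (fun s' k => I (j + 1) s' ∧ k ≤ b) s₁)
    (hend : ∀ s₁, p.Frame s s₁ → I n s₁ → c.eval s₁ = 0) (hs : I 0 s) :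
    Wp (.while c p) (fun s' k => (I n s' ∧ p.Frame s s') ∧ k ≤ n * (b + c.cost + 1) + c.cost + 1)
      s := by
  refine Wp.while (fun j s' => I j s' ∧ p.Frame s s') n b ?_ (fun s₁ h => hend s₁ h.2 h.1)
    ⟨hs, fun _ _ => rfl, fun _ _ => rfl⟩
  rintro j hj s₁ ⟨hI, hfr⟩
  obtain ⟨h₁, h₂⟩ := hbody j hj s₁ hfr hI
  refine ⟨h₁, h₂.frame.mono ?_⟩
  rintro s₂ k ⟨⟨h₃, h₄⟩, h₅, h₆⟩
  exact ⟨⟨h₃, fun r hr => (h₅ r hr).trans (hfr.1 r hr), fun a ha => (h₆ a ha).trans (hfr.2 a ha)⟩,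
    h₄⟩

/-- An expression that is nonzero if and only if the two given ones have different values. -/
def RamExpr.differ (a b : RamExpr) : RamExpr := .add (.sub a b) (.sub b a)

theorem RamExpr.eval_differ {a b : RamExpr} {s : RamState} :
    (RamExpr.differ a b).eval s = 0 ↔ a.eval s = b.eval s := by
  simp only [differ, eval]
  omega

/-- One step of a walk along the edge `e` with ends `A e` and `B e`; the second component of the
result becomes `1` if `e` does not start at the present vertex. -/
def scanStep (A B : ℕ → ℕ) (x : ℕ × ℕ) (e : ℕ) : ℕ × ℕ :=
  if x.1 = A e then (B e, x.2) else if x.1 = B e then (A e, x.2) else (x.1, 1)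

/-- Walks along the trail number `x₄`, which is stored from position `x₅` on, from the vertex `x₆`.
The last vertex is returned in `x₇`, the success in `x₈`, the parity in `x₉`. -/
def scanTrail : RamProg :=
  .block [.assign 7 (.reg 6), .assign 8 (.const 0), .assign 9 (.const 0), .assign 10 (.const 0),
    .while (.sub (.cell 2 (.reg 4)) (.reg 10)) (.block [
      .assign 11 (.cell 3 (.add (.reg 5) (.reg 10))),
      .ite (.differ (.reg 7) (.cell 0 (.reg 11)))
        (.ite (.differ (.reg 7) (.cell 1 (.reg 11))) (.assign 8 (.const 1))
          (.assign 7 (.cell 0 (.reg 11))))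
        (.assign 7 (.cell 1 (.reg 11))),
      .assign 9 (.sub (.const 1) (.reg 9)),
      .assign 10 (.add (.reg 10) (.const 1))])]

theorem wp_scanTrail {s : RamState} {T : List ℕ} (hlen : s.arr 2 (s.reg 4) = T.length)
    (hent : ∀ (j : ℕ) (hj : j < T.length), s.arr 3 (s.reg 5 + j) = T[j]) :
    Wp scanTrail (fun s' k =>
      ((s'.reg 7, s'.reg 8) = T.foldl (scanStep (s.arr 0) (s.arr 1)) (s.reg 6, 0) ∧
        s'.reg 9 = T.length % 2) ∧ k ≤ 100 * (T.length + 1)) s := by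
  refine .seq (.assign (.seq (.assign (.seq (.assign (.seq (.assign (.seq ?_))))))))
  refine (Wp.while_frame (fun j s' => ((s'.reg 7, s'.reg 8) =
    (T.take j).foldl (scanStep (s.arr 0) (s.arr 1)) (s.reg 6, 0) ∧
        s'.reg 9 = j % 2) ∧ s'.reg 10 = j) T.length 50 ?_ ?_ ?_).mono ?_
  · rintro j hj s₁ ⟨hreg, harr⟩ ⟨⟨h₁, h₂⟩, h₃⟩
    have r₄ : s₁.reg 4 = s.reg 4 := (hreg 4 (by simp [RamProg.WritesReg])).trans (by simp)
    have r₅ : s₁.reg 5 = s.reg 5 := (hreg 5 (by simp [RamProg.WritesReg])).trans (by simp)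
    have ha : s₁.arr = s.arr := funext fun a => harr a (by simp [RamProg.WritesArr])
    have he : s.arr 3 (s.reg 5 + j) = T[j] := hent j hj
    refine ⟨by simp only [RamExpr.eval, ha, r₄, h₃, hlen]; omega, ?_⟩
    have hstep : (T.take (j + 1)).foldl (scanStep (s.arr 0) (s.arr 1)) (s.reg 6, 0) =
        scanStep (s.arr 0) (s.arr 1) (s₁.reg 7, s₁.reg 8) T[j] := by
      rw [List.take_succ_eq_append_getElem hj, List.foldl_append, ← h₁]
      rfl
    rw [hstep]
    refine .seq (.assign (.seq (.ite (fun hc => .ite (fun hc' => ?_) (fun hc' => ?_))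
      (fun hc => ?_))))
    · rw [Ne, RamExpr.eval_differ] at hc hc'
      refine .assign (.seq (.assign (.seq (.assign (.skip ?_)))))
      simp [RamExpr.eval, RamExpr.cost, RamExpr.differ, ha, r₅, h₃, he, h₂] at hc hc' ⊢
      simp [scanStep, hc, hc']
      omega
    · rw [Ne, RamExpr.eval_differ] at hc
      rw [RamExpr.eval_differ] at hc'
      refine .assign (.seq (.assign (.seq (.assign (.skip ?_)))))
      simp [RamExpr.eval, RamExpr.cost, RamExpr.differ, ha, r₅, h₃, he, h₂] at hc hc' ⊢
      simp [scanStep, hc']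
      omega
    · rw [RamExpr.eval_differ] at hc
      refine .assign (.seq (.assign (.seq (.assign (.skip ?_)))))
      simp [RamExpr.eval, RamExpr.cost, RamExpr.differ, ha, r₅, h₃, he, h₂] at hc ⊢
      simp [scanStep, hc]
      omega
  · rintro s₁ ⟨hreg, harr⟩ ⟨-, h₃⟩
    have r₄ : s₁.reg 4 = s.reg 4 := (hreg 4 (by simp [RamProg.WritesReg])).trans (by simp)
    have ha : s₁.arr = s.arr := funext fun a => harr a (by simp [RamProg.WritesArr])
    simp [RamExpr.eval, ha, r₄, h₃, hlen]
  · simp [RamExpr.eval]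
  · rintro s₁ k ⟨⟨⟨h₁, -⟩, -⟩, hk⟩
    rw [List.take_length] at h₁
    simp only [RamExpr.cost] at hk
    exact .skip ⟨h₁, by simp only [RamExpr.cost]; omega⟩

/-! ### Correctness of walking along an edge sequence. -/

section Scan

variable {n m : ℕ} {G : Graph (Fin n) (Fin m)} {A B : ℕ → ℕ}

/-- Deterministic traversal follows every given walk, since a vertex and an edge at it determine the
next vertex. -/
theorem foldl_scanStep_of_isWalkFromTo
    (hG : ∀ e : Fin m, ∃ u v : Fin n, G.IsLink e u v ∧ A e = u ∧ B e = v) {T : List (Fin m)}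
    {u v : Fin n} (h : IsWalkFromTo G u T v) :
    (T.map Fin.val).foldl (scanStep A B) (u, 0) = (↑v, 0) := by
  induction T generalizing u with
  | nil =>
    obtain ⟨-, rfl⟩ := h
    rfl
  | cons e T ih =>
    obtain ⟨w, hw, h⟩ := h
    obtain ⟨a, b, hab, ha, hb⟩ := hG e
    rw [List.map_cons, List.foldl_cons, ← ih h]
    congr 1
    rw [scanStep, ha, hb]
    rcases hw.eq_and_eq_or_eq_and_eq hab with ⟨rfl, rfl⟩ | ⟨rfl, rfl⟩
    · simp
    · split <;> simp_all

/-- Failure is never forgotten, so the flag can be inspected once, at the end. -/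
theorem foldl_scanStep_one (T : List ℕ) (x : ℕ) : (T.foldl (scanStep A B) (x, 1)).2 = 1 := by
  induction T generalizing x with
  | nil => rfl
  | cons e T ih =>
    rw [List.foldl_cons, scanStep]
    split
    · exact ih _
    · split <;> exact ih _

/-- The converse: a traversal that ends without a failure flag was a walk. -/
theorem isWalkFromTo_of_foldl_scanStep (hV : V(G) = Set.univ)
    (hG : ∀ e : Fin m, ∃ u v : Fin n, G.IsLink e u v ∧ A e = u ∧ B e = v) {T : List (Fin m)}
    {u : Fin n} (h : ((T.map Fin.val).foldl (scanStep A B) (u, 0)).2 = 0) :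
    ∃ v : Fin n, ((T.map Fin.val).foldl (scanStep A B) (u, 0)).1 = v ∧ IsWalkFromTo G u T v := by
  induction T generalizing u with
  | nil => exact ⟨u, rfl, by simp [hV], rfl⟩
  | cons e T ih =>
    obtain ⟨a, b, hab, ha, hb⟩ := hG e
    rw [List.map_cons, List.foldl_cons] at h ⊢
    rw [scanStep, ha, hb] at h ⊢
    by_cases h₁ : (u : ℕ) = a
    · rw [if_pos h₁] at h ⊢
      obtain ⟨v, hv, hw⟩ := ih h
      exact ⟨v, hv, b, Fin.ext h₁ ▸ hab, hw⟩
    · rw [if_neg h₁] at h ⊢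
      by_cases h₂ : (u : ℕ) = b
      · rw [if_pos h₂] at h ⊢
        obtain ⟨v, hv, hw⟩ := ih h
        exact ⟨v, hv, a, Fin.ext h₂ ▸ hab.symm, hw⟩
      · rw [if_neg h₂, foldl_scanStep_one] at h
        exact absurd h one_ne_zero

end Scan

theorem List.getElem?_flatten_offset {β : Type*} (L : List (List β)) (k : ℕ) (hk : k < L.length)
    (j : ℕ) (hj : j < L[k].length) :
    L.flatten[(L.take k).flatten.length + j]? = some L[k][j] := by
  induction L generalizing k with
  | nil => simp at hk
  | cons T L ih =>
    cases k with
    | zero =>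
      simp only [List.getElem_cons_zero] at hj ⊢
      simp [List.getElem?_append_left, hj]
    | succ k =>
      simp only [List.getElem_cons_succ] at hj ⊢
      rw [← ih k (by simpa using hk) hj]
      simp [List.getElem?_append_right, add_assoc]

theorem RamState.StoresTrails.entry {s : RamState} {c a b m : ℕ} {L : List (List (Fin m))}
    (h : s.StoresTrails c a b L) (k : ℕ) (hk : k < L.length) (j : ℕ) (hj : j < L[k].length) :
    s.arr b ((L.take k).flatten.length + j) = L[k][j] := by
  obtain ⟨h₁, h₂⟩ := List.getElem?_eq_some_iff.1 (List.getElem?_flatten_offset L k hk j hj)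
  rw [h.entries _ h₁, h₂]

theorem frame_scanTrail {s s' : RamState} (h : scanTrail.Frame s s') :
    (∀ r, r < 7 → s'.reg r = s.reg r) ∧ s'.arr = s.arr :=
  ⟨fun r hr => h.1 r (by simp [RamProg.WritesReg, scanTrail]; omega),
    funext fun a => h.2 a (by simp [RamProg.WritesArr, scanTrail])⟩

/-- Tries both ends of the first edge as the start of a trail. -/
def scanTrailTwice : RamProg :=
  .block [.assign 6 (.cell 0 (.cell 3 (.reg 5))), scanTrail,
    .ite (.reg 8) (.block [.assign 6 (.cell 1 (.cell 3 (.reg 5))), scanTrail]) .skip]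

/-- A walk along `T` starts at an end of its first edge, so two attempts suffice. Nothing is claimed
about `u` and `v` themselves; the ends found are identified later from the sequence. -/
theorem wp_scanTrailTwice {n m : ℕ} {G : Graph (Fin n) (Fin m)} (hV : V(G) = Set.univ)
    {s : RamState} (hG : ∀ e : Fin m, ∃ u v : Fin n, G.IsLink e u v ∧ s.arr 0 e = u ∧ s.arr 1 e = v)
    {T : List (Fin m)} {u v : Fin n} (hT : IsTrailWithEnds G T u v)
    (hlen : s.arr 2 (s.reg 4) = T.length)
    (hent : ∀ (j : ℕ) (hj : j < T.length), s.arr 3 (s.reg 5 + j) = T[j]) :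
    Wp scanTrailTwice
      (fun s' k => ((∃ a b : Fin n, s'.reg 6 = a ∧ s'.reg 7 = b ∧ IsWalkFromTo G a T b) ∧
        s'.reg 9 = T.length % 2) ∧ k ≤ 250 * (T.length + 1)) s := by
  obtain ⟨e, T', rfl⟩ := List.exists_cons_of_ne_nil hT.ne_nil
  set T := e :: T' with hTdef
  obtain ⟨a, b, hab, ha, hb⟩ := hG e
  have he : s.arr 3 (s.reg 5) = e := hent 0 (by simp [hTdef])
  have hent' : ∀ (j : ℕ) (hj : j < (T.map Fin.val).length),
      s.arr 3 (s.reg 5 + j) = (T.map Fin.val)[j] := fun j hj => by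
    rw [List.getElem_map]
    exact hent j (by simpa using hj)
  have hs₁ := wp_scanTrail (s := s.setReg 6 a) (T := T.map Fin.val) (by simpa using hlen)
    (by simpa using hent')
  refine .seq (.assign (.seq ?_))
  simp only [RamExpr.eval, he, ha]
  refine hs₁.frame.mono ?_
  rintro s₁ k₁ ⟨⟨⟨h₁, h₁'⟩, hk₁⟩, hfr₁⟩
  obtain ⟨hr₁, ha₁⟩ := frame_scanTrail hfr₁
  simp only [RamState.setReg_reg, RamState.setReg_arr, if_true, List.length_map] at h₁ h₁' hk₁ ha₁
  refine .seq (.ite (fun hc => ?_) (fun hc => ?_))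
  · have hs₂ := wp_scanTrail (s := s₁.setReg 6 b) (T := T.map Fin.val)
      (by simpa [ha₁, hr₁] using hlen) (by simpa [ha₁, hr₁] using hent')
    refine .seq (.assign (.seq ?_))
    simp only [RamExpr.eval, ha₁, hr₁ 5 (by norm_num), RamState.setReg_reg,
      Nat.reduceEqDiff, if_false, he, hb]
    refine hs₂.frame.mono ?_
    rintro s₂ k₂ ⟨⟨⟨h₂, h₂'⟩, hk₂⟩, hfr₂⟩
    obtain ⟨hr₂, ha₂⟩ := frame_scanTrail hfr₂
    simp only [RamState.setReg_reg, RamState.setReg_arr, if_true, List.length_map, ha₁] at h₂ h₂' hk₂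
    refine .skip (.skip ⟨⟨?_, h₂'⟩, ?_⟩)
    · obtain ⟨x, y, hw⟩ : ∃ x y : Fin n, IsWalkFromTo G x T y := hT.ends.elim (fun h => ⟨u, v, h⟩)
        fun h => ⟨v, u, h⟩
      -- Had the walk started at `a`, the first attempt would not have failed.
      have hxb : x = b := by
        have hw' := hw
        obtain ⟨w, hl, -⟩ := hw'
        rcases hl.eq_and_eq_or_eq_and_eq hab with ⟨rfl, -⟩ | ⟨rfl, -⟩
        · rw [foldl_scanStep_of_isWalkFromTo hG hw] at h₁
          exact absurd (Prod.mk.inj h₁).2 hc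
        · rfl
      rw [hxb] at hw
      rw [foldl_scanStep_of_isWalkFromTo hG hw] at h₂
      exact ⟨b, y, by rw [hr₂ 6 (by norm_num)]; simp, (Prod.mk.inj h₂).1, hw⟩
    · simp only [RamExpr.cost]
      omega
  · refine .skip (.skip ⟨⟨?_, h₁'⟩, ?_⟩)
    · have h₃ := congrArg Prod.snd h₁
      obtain ⟨y, hy, hw⟩ := isWalkFromTo_of_foldl_scanStep hV hG (h₃.symm.trans hc)
      exact ⟨a, y, by rw [hr₁ 6 (by norm_num)]; simp, (congrArg Prod.fst h₁).trans hy, hw⟩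
    · simp only [RamExpr.cost]
      omega

theorem frame_scanTrailTwice {s s' : RamState} (h : scanTrailTwice.Frame s s') :
    (∀ r, r < 6 → s'.reg r = s.reg r) ∧ s'.arr = s.arr :=
  ⟨fun r hr => h.1 r (by simp [RamProg.WritesReg, scanTrailTwice, scanTrail]; omega),
    funext fun a => h.2 a (by simp [RamProg.WritesArr, scanTrailTwice, scanTrail])⟩

/-- Stores the ends of the trail number `k` in the cells `2 * k` and `2 * k + 1` of `A₆`, its parity
in the cell `2 * x₂ + k` of `A₇`, and its offset in the cell `k` of `A₈`. -/
def scanTrails : RamProg :=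
  .block [.assign 4 (.const 0), .assign 5 (.const 0),
    .while (.sub (.reg 2) (.reg 4)) (.block [
      .store 8 (.reg 4) (.reg 5),
      scanTrailTwice,
      .store 6 (.add (.reg 4) (.reg 4)) (.reg 6),
      .store 6 (.add (.add (.reg 4) (.reg 4)) (.const 1)) (.reg 7),
      .store 7 (.add (.add (.reg 2) (.reg 2)) (.reg 4)) (.reg 9),
      .assign 5 (.add (.reg 5) (.cell 2 (.reg 4))),
      .assign 4 (.add (.reg 4) (.const 1))])]

theorem frame_scanTrails {s s' : RamState} (h : scanTrails.Frame s s') :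
    (∀ r, r < 4 → s'.reg r = s.reg r) ∧ ∀ a < 6, s'.arr a = s.arr a :=
  ⟨fun r hr => h.1 r (by
      simp [RamProg.WritesReg, scanTrails, scanTrailTwice, scanTrail]; omega),
    fun a ha => h.2 a (by
      simp [RamProg.WritesArr, scanTrails, scanTrailTwice, scanTrail]; omega)⟩

theorem wp_scanTrails {n m : ℕ} {G : Graph (Fin n) (Fin m)} (hV : V(G) = Set.univ) {s : RamState}
    (hG : s.StoresGraph G) {L : List (List (Fin m))} (hL : s.StoresTrails 2 2 3 L)
    (hT : ∀ T ∈ L, ∃ u v, IsTrailWithEnds G T u v) :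
    Wp scanTrails (fun s' k => (∀ (i : ℕ) (hi : i < L.length),
      (∃ a b : Fin n, s'.arr 6 (2 * i) = a ∧ s'.arr 6 (2 * i + 1) = b ∧
        IsWalkFromTo G a L[i] b) ∧
      s'.arr 7 (2 * L.length + i) = L[i].length % 2 ∧
      s'.arr 8 i = (L.take i).flatten.length) ∧ k ≤ 300 * (L.length + 1) * (m + 1)) s := by
  refine .seq (.assign (.seq (.assign (.seq ?_))))
  refine (Wp.while_frame (fun j s' => (∀ (i : ℕ) (hi : i < L.length), i < j →
      (∃ a b : Fin n, s'.arr 6 (2 * i) = a ∧ s'.arr 6 (2 * i + 1) = b ∧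
        IsWalkFromTo G a L[i] b) ∧
      s'.arr 7 (2 * L.length + i) = L[i].length % 2 ∧
      s'.arr 8 i = (L.take i).flatten.length) ∧ s'.reg 4 = j ∧
      s'.reg 5 = (L.take j).flatten.length) L.length (250 * (m + 1) + 40) ?_ ?_ ?_).mono ?_
  · rintro j hj s₁ ⟨hreg, harr⟩ ⟨h₁, h₂, h₃⟩
    have r₂ : s₁.reg 2 = L.length := (hreg 2 (by
      simp [RamProg.WritesReg, scanTrailTwice, scanTrail])).trans (by simpa using hL.count)
    have ha : ∀ a < 6, s₁.arr a = s.arr a := fun a ha => harr a (by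
      simp [RamProg.WritesArr, scanTrailTwice, scanTrail]; omega)
    refine ⟨by simp only [RamExpr.eval, r₂, h₂]; omega, ?_⟩
    obtain ⟨u, v, huv⟩ := hT L[j] (List.getElem_mem hj)
    -- The edges of a trail are distinct; this keeps each round linear in the number of edges.
    have hlenm : L[j].length ≤ m := by
      simpa using huv.nodup.length_le_card
    refine .seq (.store (.seq ?_))
    have hscan := wp_scanTrailTwice (s := s₁.setCell 8 ((RamExpr.reg 4).eval s₁)
      ((RamExpr.reg 5).eval s₁)) hV (G := G) ?_ huv ?_ ?_
    · refine hscan.frame.mono ?_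
      rintro s₂ k₂ ⟨⟨⟨⟨a, b, e₁, e₂, hw⟩, e₃⟩, hk₂⟩, hfr⟩
      obtain ⟨hr₂, ha₂⟩ := frame_scanTrailTwice hfr
      have r₂' : s₂.reg 2 = L.length := by rw [hr₂ 2 (by norm_num)]; exact r₂
      have r₄' : s₂.reg 4 = j := by rw [hr₂ 4 (by norm_num)]; exact h₂
      have r₅' : s₂.reg 5 = (L.take j).flatten.length := by rw [hr₂ 5 (by norm_num)]; exact h₃
      have hlen : s₂.arr 2 j = L[j].length := by
        rw [ha₂]
        simp [ha, hL.lengths j hj]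
      refine .seq (.store (.seq (.store (.seq (.store (.seq (.assign (.seq (.assign (.skip
        ⟨⟨fun i hi hij => ?_, ?_, ?_⟩, ?_⟩))))))))))
      · simp only [RamExpr.eval, RamState.setReg_arr, RamState.setCell_arr, RamState.setCell_reg,
          r₄', e₁, e₂, e₃, r₂', ha₂, h₂, h₃]
        rcases Nat.lt_succ_iff_lt_or_eq.1 hij with hij' | rfl
        · obtain ⟨⟨a', b', g₁, g₂, g₃⟩, g₄, g₅⟩ := h₁ i hi hij'
          have n₁ : 2 * i ≠ j + j := by omega
          have n₂ : 2 * i ≠ j + j + 1 := by omega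
          have n₃ : 2 * i + 1 ≠ 2 * j := by omega
          have n₄ : 2 * L.length + i ≠ L.length + L.length + j := by omega
          refine ⟨⟨a', b', ?_, ?_, g₃⟩, ?_, ?_⟩
          · simpa [n₁, n₂] using g₁
          · simpa [n₃, hij'.ne, ← two_mul] using g₂
          · simpa [n₄] using g₄
          · simpa [hij'.ne] using g₅
        · refine ⟨⟨a, b, ?_, ?_, hw⟩, ?_, ?_⟩
          · simp [← two_mul]
          · simp [← two_mul]
          · simp [← two_mul]
          · simp
      · simp [RamExpr.eval, r₄']
      · rw [List.take_succ_eq_append_getElem hj, List.flatten_append, List.length_append]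
        simp [RamExpr.eval, r₄', r₅', hlen]
      · simp only [RamExpr.cost]
        omega
    · intro e
      simpa [ha] using hG.ends e
    · simp [RamExpr.eval, h₂, ha, hL.lengths j hj]
    · intro i hi
      simpa [RamExpr.eval, h₃, ha] using hL.entry j hj i hi
  · rintro s₁ ⟨hreg, -⟩ ⟨-, h₂, -⟩
    have r₂ : s₁.reg 2 = L.length := (hreg 2 (by
      simp [RamProg.WritesReg, scanTrailTwice, scanTrail])).trans (by simpa using hL.count)
    simp [RamExpr.eval, r₂, h₂]
  · simp [RamExpr.eval]
  · rintro s₁ k ⟨⟨⟨h₁, -⟩, -⟩, hk⟩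
    refine .skip ⟨fun i hi => h₁ i hi hi, ?_⟩
    simp only [RamExpr.cost] at hk ⊢
    nlinarith

/-- Stores the labels of the ends in the cells of `A₇`. -/
def labelEnds : RamProg :=
  .block [.assign 4 (.const 0),
    .while (.sub (.add (.reg 2) (.reg 2)) (.reg 4)) (.block [
      .assign 5 (.const 0),
      .while (.differ (.cell 6 (.reg 5)) (.cell 6 (.reg 4)))
        (.assign 5 (.add (.reg 5) (.const 1))),
      .store 7 (.reg 4) (.reg 5),
      .assign 4 (.add (.reg 4) (.const 1))])]

theorem frame_labelEnds {s s' : RamState} (h : labelEnds.Frame s s') :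
    (∀ r, r < 4 → s'.reg r = s.reg r) ∧ ∀ a, a ≠ 7 → s'.arr a = s.arr a :=
  ⟨fun r hr => h.1 r (by simp [RamProg.WritesReg, labelEnds]; omega),
    fun a ha => h.2 a (by simp [RamProg.WritesArr, labelEnds]; omega)⟩

theorem wp_labelEnds (s : RamState) :
    Wp labelEnds (fun s' k => (∀ e, s'.arr 7 e = if e < 2 * s.reg 2 then
      firstIndex (s.arr 6) (s.arr 6 e) else s.arr 7 e) ∧
      k ≤ 100 * (s.reg 2 + 1) * (s.reg 2 + 1)) s := by
  set M := s.reg 2 with hM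
  refine .seq (.assign (.seq ?_))
  refine (Wp.while_frame (fun j s' => (∀ e, s'.arr 7 e = if e < j then
      firstIndex (s.arr 6) (s.arr 6 e) else s.arr 7 e) ∧ s'.reg 4 = j) (2 * M)
      (2 * M * 20 + 30) ?_ ?_ ?_).mono ?_
  · rintro j hj s₁ ⟨hreg, harr⟩ ⟨h₁, h₂⟩
    have r₂ : s₁.reg 2 = M := (hreg 2 (by simp [RamProg.WritesReg])).trans (by simp [hM])
    have ha : s₁.arr 6 = s.arr 6 := (harr 6 (by simp [RamProg.WritesArr]))
    refine ⟨by simp only [RamExpr.eval, r₂, h₂]; omega, ?_⟩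
    -- The inner search stops at position `j` at the latest, so it takes fewer than `2 * M` rounds.
    have hle := firstIndex_le (s.arr 6) j
    refine .seq (.assign (.seq ?_))
    refine (Wp.while_frame (fun i s' => s'.reg 5 = i) (firstIndex (s.arr 6) (s.arr 6 j)) 4
      ?_ ?_ ?_).mono ?_
    · rintro i hi s₂ ⟨hreg₂, harr₂⟩ h₅
      have r₄ : s₂.reg 4 = j := (hreg₂ 4 (by simp [RamProg.WritesReg])).trans (by simp [h₂])
      have ha₂ : s₂.arr 6 = s.arr 6 := (harr₂ 6 (by simp [RamProg.WritesArr])).trans (by simp [ha])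
      refine ⟨?_, .assign ⟨by simp [RamExpr.eval, h₅], le_rfl⟩⟩
      rw [Ne, RamExpr.eval_differ]
      simp only [RamExpr.eval, r₄, h₅, ha₂]
      exact Nat.notMem_of_lt_sInf (s := {r | s.arr 6 r = s.arr 6 j}) hi
    · rintro s₂ ⟨hreg₂, harr₂⟩ h₅
      have r₄ : s₂.reg 4 = j := (hreg₂ 4 (by simp [RamProg.WritesReg])).trans (by simp [h₂])
      have ha₂ : s₂.arr 6 = s.arr 6 := (harr₂ 6 (by simp [RamProg.WritesArr])).trans (by simp [ha])
      rw [RamExpr.eval_differ]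
      simp only [RamExpr.eval, r₄, h₅, ha₂]
      exact apply_firstIndex _ _
    · simp [RamExpr.eval]
    · rintro s₂ k ⟨⟨h₅, hreg₂, harr₂⟩, hk⟩
      have r₄ : s₂.reg 4 = j := (hreg₂ 4 (by simp [RamProg.WritesReg])).trans (by simp [h₂])
      have ha₂ : s₂.arr 7 = s₁.arr 7 := harr₂ 7 (by simp [RamProg.WritesArr])
      refine .seq (.store (.seq (.assign (.skip ⟨⟨fun e => ?_, ?_⟩, ?_⟩))))
      · simp only [RamExpr.eval, RamState.setReg_arr, RamState.setCell_arr, r₄, h₅, ha₂, h₁]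
        rcases lt_trichotomy e j with h | rfl | h
        · simp [h, h.ne, h.trans (Nat.lt_succ_self j)]
        · simp
        · simp [h.ne', h.not_gt, Nat.not_lt.2 (Nat.succ_le_of_lt h)]
      · simp [RamExpr.eval, r₄]
      · simp only [RamExpr.cost, RamExpr.differ] at hk ⊢
        omega
  · rintro s₁ ⟨hreg, -⟩ ⟨-, h₂⟩
    have r₂ : s₁.reg 2 = M := (hreg 2 (by simp [RamProg.WritesReg])).trans (by simp [hM])
    simp only [RamExpr.eval, r₂, h₂]
    omega
  · simp [RamExpr.eval]
  · rintro s₁ k ⟨⟨⟨h₁, -⟩, -⟩, hk⟩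
    refine .skip ⟨h₁, ?_⟩
    simp only [RamExpr.cost] at hk ⊢
    nlinarith

/-! ### The search for a certificate -/

/-- This is the code of `a :: l` in terms of `a` and the code of `l`; a list is encoded from its end
backwards with it. -/
theorem exists_prog_encode : ∃ P : RamProg, P.WritesOnly 12 40 ∧ ∃ κ : ℕ → ℕ → ℕ, ∀ s : RamState,
    Wp P (fun s' k => s'.reg 12 = Nat.succ (Nat.pair (s.reg 13) (s.reg 12)) ∧
      k = κ (s.reg 13) (s.reg 12)) s :=
  Primrec₂.exists_prog (f := fun a x => Nat.succ (Nat.pair a x))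
    (Primrec.succ.comp (Primrec₂.natPair.comp .fst .snd)) 13 12 12 40 (by norm_num) (by norm_num)
    (by norm_num)

/-- A program that computes the code of the list of the first `3 * x₂` entries of `A₇`. -/
theorem exists_prog_encode_list : ∃ P : RamProg, (∀ r, P.WritesReg r → 4 ≤ r) ∧
    (∀ a, ¬ P.WritesArr a) ∧ ∀ D : List ℕ, ∃ F : ℕ, ∀ s : RamState, 3 * s.reg 2 = D.length →
      (∀ (e : ℕ) (he : e < D.length), s.arr 7 e = D[e]) →
      Wp P (fun s' k => s'.reg 12 = Encodable.encode D ∧ k ≤ F) s := by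
  obtain ⟨P, ⟨hP₁, hP₂⟩, κ, hP⟩ := exists_prog_encode
  refine ⟨.block [.assign 12 (.const 0), .assign 4 (.add (.add (.reg 2) (.reg 2)) (.reg 2)),
    .while (.reg 4) (.block [.assign 4 (.sub (.reg 4) (.const 1)), .assign 13 (.cell 7 (.reg 4)),
      P])], ?_, ?_, fun D => ?_⟩
  · rintro r (h | h | (h | h | h | h) | h)
    · exact h.ge.trans' (by norm_num)
    · exact h.ge
    · exact h.ge
    · exact h.ge.trans' (by norm_num)
    · have := hP₁ r h
      omega
    · exact h.elim
    · exact h.elim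
  · rintro r (h | h | (h | h | h | h) | h)
    · exact h
    · exact h
    · exact h
    · exact h
    · exact hP₂ r h
    · exact h
    · exact h
  -- The sum bounds the cost of each round and depends on `D` only.
  set b := ∑ e ∈ Finset.range D.length, κ (D.getD e 0) (Encodable.encode (D.drop (e + 1))) with hb
  refine ⟨D.length * (b + 20) + 40, fun s hs hD => ?_⟩
  refine .seq (.assign (.seq (.assign (.seq ?_))))
  refine (Wp.while_frame (fun j s' => s'.reg 4 = D.length - j ∧
    s'.reg 12 = Encodable.encode (D.drop (D.length - j))) D.length (b + 15) ?_ ?_ ?_).mono ?_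
  · rintro j hj s₁ ⟨hreg, harr⟩ ⟨h₁, h₂⟩
    have ha : s₁.arr 7 = s.arr 7 := harr 7 (by simp [RamProg.WritesArr, hP₂])
    refine ⟨by simp only [RamExpr.eval, h₁]; omega, ?_⟩
    have hlt : D.length - (j + 1) < D.length := by omega
    have e₁ : D.length - j = D.length - (j + 1) + 1 := by omega
    refine .seq (.assign (.seq (.assign (.seq ((hP _).frame.mono ?_)))))
    rintro s₂ k ⟨⟨h₃, h₄⟩, hreg₂, -⟩
    have r₄ := hreg₂ 4 fun h => by have := hP₁ 4 h; omega
    simp only [RamExpr.eval, RamState.setReg_reg, RamState.setReg_arr, Nat.reduceEqDiff, if_false,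
      if_true, h₁, h₂, ha] at r₄ h₃ h₄
    have e₂ : D.length - j - 1 = D.length - (j + 1) := by omega
    rw [e₂, hD _ hlt] at h₃ h₄
    refine .skip ⟨⟨by omega, ?_⟩, ?_⟩
    · rw [h₃, List.drop_eq_getElem_cons hlt, Encodable.encode_list_cons, e₁]
      rfl
    · have : κ D[D.length - (j + 1)] (Encodable.encode (D.drop (D.length - j))) ≤ b := by
        have := Finset.single_le_sum
          (f := fun e => κ (D.getD e 0) (Encodable.encode (D.drop (e + 1))))
          (fun _ _ => Nat.zero_le _) (Finset.mem_range.2 hlt)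
        rwa [List.getD_eq_getElem _ _ hlt, ← e₁] at this
      simp only [RamExpr.cost]
      omega
  · rintro s₁ - ⟨h₁, -⟩
    simp [RamExpr.eval, h₁]
  · simp only [RamExpr.eval, RamState.setReg_reg, Nat.reduceEqDiff, if_false, if_true, Nat.sub_zero,
      List.drop_length]
    exact ⟨by omega, rfl⟩
  · rintro s₁ k ⟨⟨⟨-, h₂⟩, -⟩, hk⟩
    refine .skip ⟨by simpa using h₂, ?_⟩
    simp only [RamExpr.cost] at hk ⊢
    nlinarith

/-- A program that finds a certificate for the list with code `x₁₂`. -/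
theorem exists_prog_search : ∃ P : RamProg, (∀ r, P.WritesReg r → 4 ≤ r) ∧
    (∀ a, ¬ P.WritesArr a) ∧ ∀ D : List ℕ, (∃ c, IsCert D c) →
      ∃ F y : ℕ, IsCert D (Denumerable.ofNat (List (List ℕ)) y) ∧ ∀ s : RamState,
        s.reg 12 = Encodable.encode D → Wp P (fun s' k => s'.reg 14 = y ∧ k ≤ F) s := by
  obtain ⟨P, ⟨hP₁, hP₂⟩, κ, hP⟩ := primrec_checkCert.exists_prog 12 14 15 40 (by norm_num)
    (by norm_num) (by norm_num)
  -- The codes `0, 1, 2, …` are tried in turn. Register `15` holds the result of the check, and the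
  -- loop goes on while it is nonzero.
  refine ⟨.block [.assign 14 (.const 0), P, .while (.reg 15) (.block [
    .assign 14 (.add (.reg 14) (.const 1)), P])], ?_, ?_, fun D hD => ?_⟩
  · rintro r (h | h | (h | h | h) | h)
    · exact h.ge.trans' (by norm_num)
    · have := hP₁ r h
      omega
    · exact h.ge.trans' (by norm_num)
    · have := hP₁ r h
      omega
    · exact h.elim
    · exact h.elim
  · rintro r (h | h | (h | h | h) | h)
    · exact h
    · exact hP₂ r h
    · exact h
    · exact hP₂ r h
    · exact h
    · exact h
  classical
  have hex : ∃ y, checkCert (Encodable.encode D) y = 0 := by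
    obtain ⟨c, hc⟩ := hD
    exact ⟨Encodable.encode c, checkCert_eq_zero.2 (by
      rwa [Denumerable.ofNat_encode, Denumerable.ofNat_encode])⟩
  set x := Encodable.encode D with hx
  -- The number of tests and the cost of each depend on `D` alone, so the bound is a function of
  -- `D`.
  set b := ∑ e ∈ Finset.range (Nat.find hex + 1), κ x e with hb
  have hle : ∀ e ≤ Nat.find hex, κ x e ≤ b := fun e he =>
    Finset.single_le_sum (f := fun e => κ x e) (fun _ _ => Nat.zero_le _)
      (Finset.mem_range.2 (Nat.lt_succ_of_le he))
  refine ⟨b + 20 + Nat.find hex * (b + 20), Nat.find hex, ?_, fun s hs => ?_⟩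
  · have := checkCert_eq_zero.1 (Nat.find_spec hex)
    rwa [show Denumerable.ofNat (List ℕ) x = D from Denumerable.ofNat_encode D] at this
  refine .seq (.assign (.seq ((hP _).frame.mono ?_)))
  rintro s₁ k₁ ⟨⟨h₁, h₁'⟩, hreg₁, -⟩
  have r₁₂ := hreg₁ 12 fun h => by have := hP₁ 12 h; omega
  have r₁₄ := hreg₁ 14 fun h => by have := hP₁ 14 h; omega
  simp only [RamExpr.eval, RamState.setReg_reg, Nat.reduceEqDiff, if_false, if_true, hs]
    at h₁ h₁' r₁₂ r₁₄
  refine .seq ((Wp.while_frame (fun j s' => s'.reg 14 = j ∧ s'.reg 15 = checkCert x j)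
    (Nat.find hex) (b + 15) ?_ ?_ ⟨r₁₄, h₁⟩).mono ?_)
  · rintro j hj s₂ ⟨hreg₂, -⟩ ⟨h₂, h₃⟩
    have q₁₂ : s₂.reg 12 = x := (hreg₂ 12 (by
      simp only [RamProg.WritesReg, List.foldr, Nat.reduceEqDiff, or_false, false_or]
      intro h
      have := hP₁ 12 h
      omega)).trans r₁₂
    refine ⟨fun h => Nat.find_min hex hj (h₃.symm.trans h), ?_⟩
    refine .seq (.assign (.seq ((hP _).frame.mono ?_)))
    rintro s₃ k₃ ⟨⟨h₄, h₄'⟩, hreg₃, -⟩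
    have q₁₄ := hreg₃ 14 fun h => by have := hP₁ 14 h; omega
    simp only [RamExpr.eval, RamState.setReg_reg, Nat.reduceEqDiff, if_false, if_true, q₁₂, h₂]
      at h₄ h₄' q₁₄
    refine .skip ⟨⟨q₁₄, h₄⟩, ?_⟩
    have := hle (j + 1) hj
    simp only [RamExpr.cost]
    omega
  · rintro s₂ - ⟨-, h₃⟩
    exact h₃.trans (Nat.find_spec hex)
  · rintro s₂ k₂ ⟨⟨⟨h₂, -⟩, -⟩, hk⟩
    refine .skip ⟨h₂, ?_⟩
    have := hle 0 (Nat.zero_le _)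
    simp only [RamExpr.cost] at hk ⊢
    nlinarith

/-! ### The output of the branch trails -/

/-- The array starts with the entries of the list. -/
def StoresList (A : ℕ → ℕ) (W : List ℕ) : Prop := ∀ i < W.length, A i = W.getD i 0

/-- `A₂` holds the lengths of the edge sequences and `A₈` their offsets in `A₃`; the sequences are
followed by an empty one. -/
def RamState.StoresSequences (s : RamState) (L : List (List ℕ)) : Prop :=
  ∀ k ≤ L.length, s.arr 2 k = (L.getD k []).length ∧
    ∀ j < (L.getD k []).length, s.arr 3 (s.arr 8 k + j) = (L.getD k []).getD j 0

theorem length_piece {β : Type*} (L : List (List β)) (z : ℕ) :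
    (piece L z).length = (L.getD (z / 2) []).length := by
  rw [piece]
  split <;> simp

theorem piece_getD (L : List (List ℕ)) {z j : ℕ} (hj : j < (L.getD (z / 2) []).length) :
    (piece L z).getD j 0 = if z % 2 = 0 then (L.getD (z / 2) []).getD j 0
      else (L.getD (z / 2) []).getD ((L.getD (z / 2) []).length - (j + 1)) 0 := by
  rw [piece]
  generalize L.getD (z / 2) [] = T at *
  split
  · rfl
  · rw [List.getD_eq_getElem _ _ (by simpa using hj), List.getElem_reverse,
      List.getD_eq_getElem _ _ (by omega)]
    congr 1
    omega

theorem primrec_codeEntry_div : Primrec₂ fun y i => codeEntry 4 y i / 2 :=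
  Primrec.nat_div.comp (primrec_codeEntry 4) (.const 2)

theorem primrec_codeEntry_mod : Primrec₂ fun y i => codeEntry 4 y i % 2 :=
  Primrec.nat_mod.comp (primrec_codeEntry 4) (.const 2)

/-- A program that writes the piece number `x₁₈` of the certificate with code `x₁₄`. -/
theorem exists_prog_piece : ∃ P : RamProg,
    (∀ r, P.WritesReg r → r = 17 ∨ r = 20 ∨ r = 21 ∨ r = 22 ∨ 40 ≤ r) ∧
    (∀ a, P.WritesArr a → a = 4 ∨ a = 5) ∧ ∀ y q : ℕ, ∃ F : ℕ, ∀ (m : ℕ) (L : List (List ℕ))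
      (s : RamState) (W : List ℕ), s.StoresSequences L → (∀ k, (L.getD k []).length ≤ m) →
      s.reg 14 = y → s.reg 18 = q → codeEntry 4 y q / 2 ≤ L.length → s.reg 17 = W.length →
      StoresList (s.arr 5) W →
      Wp P (fun s' k => (s'.reg 17 = (W ++ piece L (codeEntry 4 y q)).length ∧
        StoresList (s'.arr 5) (W ++ piece L (codeEntry 4 y q)) ∧
        ∀ i, s'.arr 4 i = if i = s.reg 4 then s.arr 4 i + (piece L (codeEntry 4 y q)).length
          else s.arr 4 i) ∧ k ≤ F + 50 * m) s := by
  obtain ⟨P, ⟨hP₁, hP₂⟩, κ, hP⟩ := primrec_codeEntry_div.exists_prog 14 18 20 40 (by norm_num)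
    (by norm_num) (by norm_num)
  obtain ⟨P', ⟨hP₁', hP₂'⟩, κ', hP'⟩ := primrec_codeEntry_mod.exists_prog 14 18 21 40 (by norm_num)
    (by norm_num) (by norm_num)
  -- Register `20` holds the trail number, `21` the direction, `22` the position in the trail, `17`
  -- the next free cell of the output. The trail's length is added to cell `A₄[x₄]`, so consecutive
  -- pieces accumulate to one branch trail.
  refine ⟨.block [P, P', .assign 22 (.const 0),
    .while (.sub (.cell 2 (.reg 20)) (.reg 22)) (.block [
      .ite (.reg 21)
        (.store 5 (.reg 17) (.cell 3 (.sub (.add (.cell 8 (.reg 20)) (.cell 2 (.reg 20)))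
          (.add (.reg 22) (.const 1)))))
        (.store 5 (.reg 17) (.cell 3 (.add (.cell 8 (.reg 20)) (.reg 22)))),
      .assign 17 (.add (.reg 17) (.const 1)),
      .assign 22 (.add (.reg 22) (.const 1))]),
    .store 4 (.reg 4) (.add (.cell 4 (.reg 4)) (.cell 2 (.reg 20)))], ?_, ?_, fun y q =>
    ⟨κ y q + κ' y q + 50, fun m L s W hL hm hy hq hz hW hsW => ?_⟩⟩
  · simp only [RamProg.WritesReg, List.foldr, or_false, false_or]
    rintro r (h | h | h | h | h)
    · have := hP₁ r h
      omega
    · have := hP₁' r h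
      omega
    all_goals omega
  · simp only [RamProg.WritesArr, List.foldr, or_false, false_or]
    rintro a (h | h | h | h)
    · exact absurd h (hP₂ a)
    · exact absurd h (hP₂' a)
    all_goals omega
  set z := codeEntry 4 y q with hzdef
  set T := L.getD (z / 2) [] with hT
  refine .seq ((hP s).frame.mono ?_)
  rintro s₁ k₁ ⟨⟨h₁, hk₁⟩, hreg₁, harr₁⟩
  have ha₁ : s₁.arr = s.arr := funext fun a => harr₁ a (hP₂ a)
  have hr₁ : ∀ r, r < 40 → r ≠ 20 → s₁.reg r = s.reg r := fun r hr hr' => hreg₁ r fun h => by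
    have := hP₁ r h
    omega
  refine .seq ((hP' s₁).frame.mono ?_)
  rintro s₂ k₂ ⟨⟨h₂, hk₂⟩, hreg₂, harr₂⟩
  have ha₂ : s₂.arr = s.arr := (funext fun a => harr₂ a (hP₂' a)).trans ha₁
  have hr₂ : ∀ r, r < 40 → r ≠ 21 → s₂.reg r = s₁.reg r := fun r hr hr' => hreg₂ r fun h => by
    have := hP₁' r h
    omega
  rw [hy, hq] at h₁ hk₁
  rw [hr₁ 14 (by norm_num) (by norm_num), hr₁ 18 (by norm_num) (by norm_num), hy, hq] at h₂ hk₂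
  have r₂₀ : s₂.reg 20 = z / 2 := (hr₂ 20 (by norm_num) (by norm_num)).trans h₁
  have r₁₇ : s₂.reg 17 = W.length := by
    rw [hr₂ 17 (by norm_num) (by norm_num), hr₁ 17 (by norm_num) (by norm_num), hW]
  have r₄ : s₂.reg 4 = s.reg 4 := by
    rw [hr₂ 4 (by norm_num) (by norm_num), hr₁ 4 (by norm_num) (by norm_num)]
  obtain ⟨hlen, hent⟩ := hL (z / 2) hz
  rw [← hT] at hlen hent
  refine .seq (.assign (.seq ?_))
  refine (Wp.while_frame (fun j s' => s'.reg 22 = j ∧ s'.reg 17 = W.length + j ∧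
    ∀ i < W.length + j, s'.arr 5 i = (W ++ piece L z).getD i 0) T.length 30 ?_ ?_ ?_).mono ?_
  · rintro j hj s₃ ⟨hreg₃, harr₃⟩ ⟨h₃, h₄, h₅⟩
    have a₂ : s₃.arr 2 = s.arr 2 := (harr₃ 2 (by simp [RamProg.WritesArr])).trans (by simp [ha₂])
    have a₃ : s₃.arr 3 = s.arr 3 := (harr₃ 3 (by simp [RamProg.WritesArr])).trans (by simp [ha₂])
    have a₈ : s₃.arr 8 = s.arr 8 := (harr₃ 8 (by simp [RamProg.WritesArr])).trans (by simp [ha₂])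
    have q₂₀ : s₃.reg 20 = z / 2 := (hreg₃ 20 (by simp [RamProg.WritesReg])).trans (by simp [r₂₀])
    have q₂₁ : s₃.reg 21 = z % 2 := (hreg₃ 21 (by simp [RamProg.WritesReg])).trans
      (by simp [h₂, hzdef])
    refine ⟨by simp only [RamExpr.eval, a₂, q₂₀, h₃, hlen]; omega, ?_⟩
    have key : (W ++ piece L z).getD (W.length + j) 0 = (piece L z).getD j 0 := by
      rw [List.getD_append_right _ _ _ _ (by omega), Nat.add_sub_cancel_left]
    have hp := piece_getD L hj
    rw [← hT] at hp
    refine .seq (.ite (fun hc => ?_) (fun hc => ?_))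
    · simp only [RamExpr.eval, q₂₁] at hc
      rw [if_neg hc] at hp
      refine .store (.seq (.assign (.seq (.assign (.skip ⟨⟨?_, ?_, fun i hi => ?_⟩, ?_⟩)))))
      · simp [RamExpr.eval, h₃]
      · simp [RamExpr.eval, h₄, add_assoc]
      · simp only [RamExpr.eval, RamState.setReg_arr, RamState.setCell_arr, a₂, a₃, a₈, q₂₀, h₃, h₄,
          hlen, true_and]
        by_cases hi' : i = W.length + j
        · rw [if_pos hi', hi', key, hp, ← hent _ (by omega)]
          congr 1
          omega
        · rw [if_neg hi']
          exact h₅ i (by omega)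
      · simp only [RamExpr.cost]
        omega
    · simp only [RamExpr.eval, q₂₁] at hc
      rw [if_pos hc] at hp
      refine .store (.seq (.assign (.seq (.assign (.skip ⟨⟨?_, ?_, fun i hi => ?_⟩, ?_⟩)))))
      · simp [RamExpr.eval, h₃]
      · simp [RamExpr.eval, h₄, add_assoc]
      · simp only [RamExpr.eval, RamState.setReg_arr, RamState.setCell_arr, a₃, a₈, q₂₀, h₃, h₄,
          true_and]
        by_cases hi' : i = W.length + j
        · rw [if_pos hi', hi', key, hp, ← hent _ hj]
        · rw [if_neg hi']
          exact h₅ i (by omega)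
      · simp only [RamExpr.cost]
        omega
  · rintro s₃ ⟨hreg₃, harr₃⟩ ⟨h₃, -⟩
    have a₂ : s₃.arr 2 = s.arr 2 := (harr₃ 2 (by simp [RamProg.WritesArr])).trans (by simp [ha₂])
    have q₂₀ : s₃.reg 20 = z / 2 := (hreg₃ 20 (by simp [RamProg.WritesReg])).trans (by simp [r₂₀])
    simp [RamExpr.eval, a₂, q₂₀, h₃, hlen]
  · refine ⟨by simp [RamExpr.eval], by simp [r₁₇], fun i hi => ?_⟩
    rw [List.getD_append _ _ _ _ (by simpa using hi)]
    simpa [ha₂] using hsW i (by simpa using hi)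
  · rintro s₃ k₃ ⟨⟨⟨-, h₄, h₅⟩, hreg₃, harr₃⟩, hk₃⟩
    have a₂ : s₃.arr 2 = s.arr 2 := (harr₃ 2 (by simp [RamProg.WritesArr])).trans (by simp [ha₂])
    have a₄ : s₃.arr 4 = s.arr 4 := (harr₃ 4 (by simp [RamProg.WritesArr])).trans (by simp [ha₂])
    have q₄ : s₃.reg 4 = s.reg 4 := (hreg₃ 4 (by simp [RamProg.WritesReg])).trans (by simp [r₄])
    have q₂₀ : s₃.reg 20 = z / 2 := (hreg₃ 20 (by simp [RamProg.WritesReg])).trans (by simp [r₂₀])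
    have hl : (W ++ piece L z).length = W.length + T.length := by
      rw [List.length_append, length_piece]
    refine .seq (.store (.skip ⟨⟨?_, fun i hi => ?_, fun i => ?_⟩, ?_⟩))
    · rw [hl]
      exact h₄
    · rw [hl] at hi
      simpa using h₅ i hi
    · simp only [RamExpr.eval, RamState.setCell_arr, q₄, a₄, a₂, q₂₀, hlen, true_and, length_piece]
      by_cases hi : i = s.reg 4
      · rw [if_pos hi, if_pos hi, hi]
      · rw [if_neg hi, if_neg hi]
    · have := hm (z / 2)
      rw [← hT] at this
      simp only [RamExpr.cost] at hk₃ ⊢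
      omega

/-- A program that writes the branch trails described by the certificate with code `x₁₄`. -/
theorem exists_prog_output : ∃ P : RamProg, ∀ y : ℕ, ∃ F : ℕ, ∀ (m : ℕ) (L : List (List ℕ))
    (s : RamState), (s.setCell 2 L.length 0).StoresSequences L → s.reg 2 = L.length →
      (∀ k, (L.getD k []).length ≤ m) → s.reg 14 = y →
      (∀ q < 3 * codeEntry 0 y 1, codeEntry 4 y q / 2 ≤ L.length) →
      Wp P (fun s' k => (s'.reg 3 = codeEntry 0 y 1 ∧
        (∀ i < codeEntry 0 y 1, s'.arr 4 i = (certTrail L (Denumerable.ofNat _ y) i).length) ∧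
        StoresList (s'.arr 5) (certTrails L (Denumerable.ofNat _ y)).flatten) ∧ k ≤ F * (m + 1))
        s := by
  obtain ⟨P, ⟨hP₁, hP₂⟩, κ, hP⟩ := (primrec_codeEntry 0).exists_prog 14 19 3 40 (by norm_num)
    (by norm_num) (by norm_num)
  obtain ⟨E, hE₁, hE₂, hE⟩ := exists_prog_piece
  -- Entry `1` of list `0` is the number of branch trails. Storing length `0` behind the last trail
  -- makes the empty piece an ordinary one; its offset is never read.
  refine ⟨.block [.assign 19 (.const 1), P, .store 2 (.reg 2) (.const 0), .assign 17 (.const 0),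
    .assign 4 (.const 0),
    .while (.sub (.reg 3) (.reg 4)) (.block [.store 4 (.reg 4) (.const 0),
      .assign 18 (.add (.add (.reg 4) (.reg 4)) (.reg 4)), E,
      .assign 18 (.add (.reg 18) (.const 1)), E, .assign 18 (.add (.reg 18) (.const 1)), E,
      .assign 4 (.add (.reg 4) (.const 1))])], fun y => ?_⟩
  choose F hF using hE y
  set Q := codeEntry 0 y 1 with hQ
  set c : List (List ℕ) := Denumerable.ofNat _ y with hc
  set b := ∑ q ∈ Finset.range (3 * Q), F q with hb
  refine ⟨κ y 1 + Q * (3 * b + 250) + 50, fun m L s hL hs₂ hm hy hq => ?_⟩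
  refine .seq (.assign (.seq ((hP _).frame.mono ?_)))
  rintro s₁ k₁ ⟨⟨h₁, hk₁⟩, hreg₁, harr₁⟩
  have ha₁ : s₁.arr = s.arr := funext fun a => harr₁ a (hP₂ a)
  have hr₁ : ∀ r, r < 19 → r ≠ 3 → s₁.reg r = s.reg r := fun r hr hr' =>
    (hreg₁ r fun h => by have := hP₁ r h; omega).trans (by simp [hr.ne])
  simp only [RamExpr.eval, RamState.setReg_reg, Nat.reduceEqDiff, if_false, if_true, hy] at h₁ hk₁
  rw [← hQ] at h₁
  refine .seq (.store (.seq (.assign (.seq (.assign (.seq ?_))))))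
  -- The state in which `W` has been written, `r` is the current branch trail and `q` the current
  -- piece number.
  let J : RamState → List ℕ → ℕ → ℕ → Prop := fun s' W q r => s'.StoresSequences L ∧
    s'.reg 14 = y ∧ s'.reg 3 = Q ∧ s'.reg 4 = r ∧ s'.reg 18 = q ∧ s'.reg 17 = W.length ∧
    StoresList (s'.arr 5) W
  have hstep : ∀ s' W q r, J s' W q r → q < 3 * Q → Wp E (fun s'' k =>
      (J s'' (W ++ piece L (certEntry c 4 q)) q r ∧ ∀ i, s''.arr 4 i =
        if i = r then s'.arr 4 i + (piece L (certEntry c 4 q)).length else s'.arr 4 i) ∧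
      k ≤ b + 50 * m) s' := by
    rintro s' W q r ⟨j₁, j₂, j₃, j₄, j₅, j₆, j₇⟩ hqQ
    refine (hF q m L s' W j₁ hm j₂ j₅ (hq q hqQ) j₆ j₇).frame.mono ?_
    rintro s'' k ⟨⟨⟨g₁, g₂, g₃⟩, hk⟩, hreg, harr⟩
    have hr : ∀ r, r < 20 → r ≠ 17 → s''.reg r = s'.reg r := fun r hr hr' =>
      hreg r fun h => by have := hE₁ r h; omega
    have ha : ∀ a, a ≠ 4 → a ≠ 5 → s''.arr a = s'.arr a := fun a h₄ h₅ =>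
      harr a fun h => by have := hE₂ a h; omega
    refine ⟨⟨⟨fun k hk => ?_, ?_, ?_, ?_, ?_, g₁, g₂⟩, ?_⟩, ?_⟩
    · rw [ha 2 (by norm_num) (by norm_num), ha 3 (by norm_num) (by norm_num),
        ha 8 (by norm_num) (by norm_num)]
      exact j₁ k hk
    · rw [hr 14 (by norm_num) (by norm_num), j₂]
    · rw [hr 3 (by norm_num) (by norm_num), j₃]
    · rw [hr 4 (by norm_num) (by norm_num), j₄]
    · rw [hr 18 (by norm_num) (by norm_num), j₅]
    · rw [j₄] at g₃
      exact g₃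
    · have := Finset.single_le_sum (f := F) (fun _ _ => Nat.zero_le _) (Finset.mem_range.2 hqQ)
      omega
  let out : ℕ → List ℕ := fun j => ((List.range j).map (certTrail L c)).flatten
  refine (Wp.while (fun j s' => (∃ q, J s' (out j) q j) ∧
    ∀ i < j, s'.arr 4 i = (certTrail L c i).length) Q (3 * b + 150 * m + 100) ?_ ?_ ?_).mono ?_
  · rintro j hj s₂ ⟨⟨q, j₁, j₂, j₃, j₄, j₅, j₆, j₇⟩, h₂⟩
    refine ⟨by simp only [RamExpr.eval, j₃, j₄]; omega, ?_⟩
    refine .seq (.store (.seq (.assign (.seq ?_))))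
    have hJ : J ((s₂.setCell 4 ((RamExpr.reg 4).eval s₂) ((RamExpr.const 0).eval s₂)).setReg 18
        ((RamExpr.add (.add (.reg 4) (.reg 4)) (.reg 4)).eval
          (s₂.setCell 4 ((RamExpr.reg 4).eval s₂) ((RamExpr.const 0).eval s₂))))
        (out j) (3 * j) j := by
      refine ⟨fun k hk => by simpa using j₁ k hk, by simpa using j₂, by simpa using j₃,
        by simpa using j₄, ?_, by simpa using j₆, fun i hi => by simpa using j₇ i hi⟩
      simp only [RamExpr.eval, RamState.setReg_reg, RamState.setCell_reg, if_true, j₄]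
      omega
    refine (hstep _ _ _ _ hJ (by omega)).mono ?_
    rintro s₃ k₃ ⟨⟨⟨i₁, i₂, i₃, i₄, i₅, i₆, i₇⟩, g₃⟩, hk₃⟩
    refine .seq (.assign (.seq ?_))
    refine (hstep (s₃.setReg 18 _) _ (3 * j + 1) j ⟨i₁, by simpa using i₂, by simpa using i₃,
      by simpa using i₄, by simp [RamExpr.eval, i₅], by simpa using i₆, i₇⟩ (by omega)).mono ?_
    rintro s₄ k₄ ⟨⟨⟨l₁, l₂, l₃, l₄, l₅, l₆, l₇⟩, g₄⟩, hk₄⟩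
    refine .seq (.assign (.seq ?_))
    refine (hstep (s₄.setReg 18 _) _ (3 * j + 2) j ⟨l₁, by simpa using l₂, by simpa using l₃,
      by simpa using l₄, by simp [RamExpr.eval, l₅], by simpa using l₆, l₇⟩ (by omega)).mono ?_
    rintro s₅ k₅ ⟨⟨⟨m₁, m₂, m₃, m₄, m₅, m₆, m₇⟩, g₅⟩, hk₅⟩
    have hout : out (j + 1) = out j ++ piece L (certEntry c 4 (3 * j)) ++
        piece L (certEntry c 4 (3 * j + 1)) ++ piece L (certEntry c 4 (3 * j + 2)) := by
      simp [out, List.range_succ, certTrail]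
    refine .seq (.assign (.skip ⟨⟨⟨3 * j + 2, ?_⟩, fun i hi => ?_⟩, ?_⟩))
    · rw [hout]
      exact ⟨m₁, by simpa using m₂, by simpa using m₃, by simp [RamExpr.eval, m₄],
        by simpa using m₅, by simpa using m₆, m₇⟩
    · simp only [RamState.setReg_arr, g₅, g₄, g₃, RamState.setCell_arr, RamExpr.eval, j₄, true_and]
      rcases Nat.lt_succ_iff_lt_or_eq.1 hi with hi' | rfl
      · simp only [hi'.ne, if_false]
        exact h₂ i hi'
      · simp only [if_true, certTrail, List.length_append]
        omega
    · simp only [RamExpr.cost]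
      omega
  · rintro s₂ ⟨⟨q, j₁, j₂, j₃, j₄, -⟩, -⟩
    simp [RamExpr.eval, j₃, j₄]
  · refine ⟨⟨_, ?_, ?_, ?_, ?_, rfl, ?_, ?_⟩, by simp⟩
    · intro k hk
      simpa [RamExpr.eval, ha₁, hr₁, hs₂] using hL k hk
    · simp [hr₁, hy]
    · simp [h₁]
    · simp [RamExpr.eval]
    · simp [RamExpr.eval, out]
    · intro i hi
      simp [out] at hi
  · rintro s₂ k₂ ⟨⟨⟨q, j₁, j₂, j₃, j₄, j₅, j₆, j₇⟩, h₂⟩, hk₂⟩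
    refine .skip ⟨⟨j₃, h₂, j₇⟩, ?_⟩
    simp only [RamExpr.cost] at hk₂ ⊢
    nlinarith [Nat.zero_le (Q * b * m), Nat.zero_le (Q * m), Nat.zero_le (κ y 1 * m)]

/-! ### The theorem -/

/-- The product `(70 x + 71) (70 x + 70)` is strictly increasing in `x`, so the condition on the
order in a certificate leaves only `t`. -/
theorem Immersion.IsTrailList.certEntry_eq {α β : Type*} {G : Graph α β} {t : ℕ}
    {φ : Immersion (cliqueGraph (70 * t + 71)) G} {L : List (List β)} (h : φ.IsTrailList L)
    {f : ℕ → α} {c : List (List ℕ)} (hc : IsCert (trailData f L) c) : certEntry c 0 0 = t := by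
  have h₁ := hc.order
  rw [length_trailData, Nat.mul_div_cancel_left _ (by norm_num), h.two_mul_length] at h₁
  change _ = (70 * t + 71) * (70 * t + 70) at h₁
  rcases lt_trichotomy (certEntry c 0 0) t with hlt | heq | hlt
  · exact absurd h₁ (Nat.mul_lt_mul_of_lt_of_lt (by omega) (by omega)).ne
  · exact heq
  · exact absurd h₁ (Nat.mul_lt_mul_of_lt_of_lt (by omega) (by omega)).ne'

/-- The certificate argument needs only the finitely many branch trails, so it applies to infinite
graphs as well. -/
theorem exists_totallyEven_immersion {α β : Type*} {G : Graph α β} {t : ℕ}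
    (φ : Immersion (cliqueGraph (70 * t + 71)) G) :
    ∃ ψ : Immersion (cliqueGraph t) G, ψ.TotallyEven := by
  classical
  let L : List (List β) := (Finset.univ : Finset E(cliqueGraph (70 * t + 71))).toList.map φ.trail
  have hL : φ.IsTrailList L :=
    ⟨(Finset.nodup_toList _).map φ.trail_injective, fun T => by simp [L]⟩
  have hends : ∀ k, ∃ p : α × α, ∀ hk : k < L.length, IsWalkFromTo G p.1 L[k] p.2 := by
    intro k
    by_cases hk : k < L.length
    · obtain ⟨u, v, -, h⟩ := hL.exists_ends (List.getElem_mem hk)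
      rcases h.ends with h | h
      · exact ⟨(u, v), fun _ => h⟩
      · exact ⟨(v, u), fun _ => h⟩
    · have x : α := φ.vert ⟨0, trivial⟩
      exact ⟨(x, x), fun h => absurd h hk⟩
  choose p hp using hends
  let f : ℕ → α := fun e => if e % 2 = 0 then (p (e / 2)).1 else (p (e / 2)).2
  have hf : ∀ (k : ℕ) (hk : k < L.length), IsWalkFromTo G (f (2 * k)) L[k] (f (2 * k + 1)) := by
    intro k hk
    have e₁ : (2 * k + 1) / 2 = k := by omega
    have e₂ : (2 * k + 1) % 2 = 1 := by omega
    simpa [f, e₁, e₂] using hp k hk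
  obtain ⟨c, hc⟩ := hL.exists_isCert hf
  obtain ⟨ψ, hψ, -⟩ := hc.exists_immersion hf hL.nodup_flatten
  exact hL.certEntry_eq hc ▸ ⟨ψ, hψ⟩

/-- The reason why the search cost is bounded: for fixed `t` only finitely many summaries can occur.
-/
theorem finite_bounded_lists (n B : ℕ) : {D : List ℕ | D.length = n ∧ ∀ x ∈ D, x < B}.Finite := by
  refine ((List.finite_length_eq (Fin B) n).image (List.map Fin.val)).subset ?_
  rintro D ⟨hD, hB⟩
  refine ⟨D.pmap (fun x hx => ⟨x, hx⟩) hB, by simpa using hD, ?_⟩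
  rw [List.map_pmap]
  simp

/-- A first occurrence is never later than the given one, so cells from `N` on, whose content is
arbitrary, play no role. -/
theorem firstIndex_congr {α : Type*} {f : ℕ → α} {g : ℕ → ℕ} {i : α → ℕ}
    (hi : Function.Injective i) {N : ℕ} (h : ∀ e < N, g e = i (f e)) {e : ℕ} (he : e < N) :
    firstIndex g (g e) = firstIndex f (f e) := by
  apply le_antisymm
  · refine Nat.sInf_le (s := {r | g r = g e}) ?_
    change g _ = g e
    rw [h _ ((firstIndex_le f e).trans_lt he), apply_firstIndex f, h e he]
  · refine Nat.sInf_le (s := {r | f r = f e}) (hi ?_)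
    rw [← h _ ((firstIndex_le g e).trans_lt he), apply_firstIndex g, h e he]

theorem piece_map {β : Type*} (g : β → ℕ) (L : List (List β)) (z : ℕ) :
    piece (L.map (List.map g)) z = (piece L z).map g := by
  have h : (L.map (List.map g)).getD (z / 2) [] = (L.getD (z / 2) []).map g := by
    simp only [List.getD_eq_getElem?_getD, List.getElem?_map]
    cases L[z / 2]? <;> rfl
  rw [piece, piece, h]
  split <;> simp

theorem certTrail_map {β : Type*} (g : β → ℕ) (L : List (List β)) (c : List (List ℕ)) (r : ℕ) :
    certTrail (L.map (List.map g)) c r = (certTrail L c r).map g := by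
  simp [certTrail, piece_map]

/-- Guarantees that the output program only reads stored trails or the empty sequence behind them.
-/
theorem IsCert.piece_le {D : List ℕ} {c : List (List ℕ)} (h : IsCert D c) {q : ℕ}
    (hq : q < 3 * certEntry c 0 1) : certEntry c 4 q / 2 ≤ D.length / 3 := by
  have hz : ∀ z x y, IsPiece D z x y → z / 2 ≤ D.length / 3 := by
    rintro z x y (⟨h, -⟩ | ⟨h, -⟩) <;> omega
  obtain ⟨h₁, h₂, h₃⟩ := h.isPiece (q / 3) (by omega)
  have h : q = 3 * (q / 3) ∨ q = 3 * (q / 3) + 1 ∨ q = 3 * (q / 3) + 2 := by omega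
  rcases h with h | h | h <;> rw [h]
  · exact hz _ _ _ h₁
  · exact hz _ _ _ h₂
  · exact hz _ _ _ h₃

theorem storesTrails_certTrails {m : ℕ} {L : List (List (Fin m))} {c : List (List ℕ)}
    {s : RamState} (h₁ : s.reg 3 = certEntry c 0 1)
    (h₂ : ∀ i < certEntry c 0 1,
      s.arr 4 i = (certTrail (L.map (List.map Fin.val)) c i).length)
    (h₃ : StoresList (s.arr 5) (certTrails (L.map (List.map Fin.val)) c).flatten) :
    s.StoresTrails 3 4 5 (certTrails L c) := by
  have hflat : (certTrails (L.map (List.map Fin.val)) c).flatten =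
      (certTrails L c).flatten.map Fin.val := by
    rw [List.map_flatten, certTrails, certTrails, List.map_map]
    congr 2
    ext1 r
    exact certTrail_map _ _ _ _
  refine ⟨by simp [certTrails, h₁], fun i hi => ?_, fun j hj => ?_⟩
  · rw [h₂ i (by simpa [certTrails] using hi), certTrail_map]
    simp [certTrails]
  · have hj' : j < ((certTrails L c).flatten.map Fin.val).length := by rwa [List.length_map]
    rw [hflat] at h₃
    rw [h₃ j hj', List.getD_eq_getElem _ _ hj', List.getElem_map]

theorem length_flatten_le {m : ℕ} {L : List (List (Fin m))} (h : L.flatten.Nodup) (k : ℕ) :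
    ((L.map (List.map Fin.val)).getD k []).length ≤ m := by
  by_cases hk : k < L.length
  · rw [List.getD_eq_getElem _ _ (by simpa using hk), List.getElem_map, List.length_map]
    simpa using ((List.nodup_flatten.1 h).1 _ (List.getElem_mem hk)).length_le_card
  · rw [List.getD_eq_default _ _ (by simpa using hk)]
    simp

/-- A program that works for the inputs that are summarised in the given list, after the ends,
parities and labels of the trails have been stored. -/
theorem exists_prog_of_trailData : ∃ P : RamProg, ∀ D : List ℕ, (∃ c, IsCert D c) →
    ∃ F : ℕ, ∀ (m : ℕ) (L : List (List (Fin m))) (s : RamState), L.flatten.Nodup →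
      D.length = 3 * L.length → s.reg 2 = L.length →
      (∀ (k : ℕ) (hk : k < L.length), s.arr 2 k = L[k].length ∧
        ∀ (j : ℕ) (hj : j < L[k].length), s.arr 3 (s.arr 8 k + j) = L[k][j]) →
      (∀ (e : ℕ) (he : e < D.length), s.arr 7 e = D[e]) →
      Wp P (fun s' k => (∃ c, IsCert D c ∧ s'.StoresTrails 3 4 5 (certTrails L c)) ∧
        k ≤ F * (m + 1)) s := by
  obtain ⟨P₁, hr₁, ha₁, hP₁⟩ := exists_prog_encode_list
  obtain ⟨P₂, hr₂, ha₂, hP₂⟩ := exists_prog_search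
  obtain ⟨P₃, hP₃⟩ := exists_prog_output
  refine ⟨.seq P₁ (.seq P₂ P₃), fun D hD => ?_⟩
  obtain ⟨F₁, hF₁⟩ := hP₁ D
  obtain ⟨F₂, y, hy, hF₂⟩ := hP₂ D hD
  obtain ⟨F₃, hF₃⟩ := hP₃ y
  refine ⟨F₁ + F₂ + F₃, fun m L s hL hDL hs₂ hmem h7 => ?_⟩
  refine .seq ((hF₁ s (by rw [hs₂, hDL]) h7).frame.mono ?_)
  rintro s₁ k₁ ⟨⟨h₁, hk₁⟩, hreg₁, harr₁⟩
  refine .seq ((hF₂ s₁ h₁).frame.mono ?_)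
  rintro s₂ k₂ ⟨⟨h₂, hk₂⟩, hreg₂, harr₂⟩
  have harr : s₂.arr = s.arr := funext fun a => (harr₂ a (ha₂ a)).trans (harr₁ a (ha₁ a))
  have hreg : s₂.reg 2 = L.length := by
    rw [hreg₂ 2 fun h => absurd (hr₂ 2 h) (by norm_num),
      hreg₁ 2 fun h => absurd (hr₁ 2 h) (by norm_num), hs₂]
  refine (hF₃ m (L.map (List.map Fin.val)) s₂ ?_ (by simpa using hreg) (length_flatten_le hL) h₂
    ?_).mono ?_
  · intro k hk
    rw [List.length_map] at hk
    -- The case `k = L.length` is the appended empty sequence: its length cell was just cleared and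
    -- it has no entries to check.
    rcases hk.lt_or_eq with hk' | rfl
    · obtain ⟨g₁, g₂⟩ := hmem k hk'
      have hg : (L.map (List.map Fin.val)).getD k [] = L[k].map Fin.val := by
        rw [List.getD_eq_getElem _ _ (by simpa using hk'), List.getElem_map]
      rw [hg]
      refine ⟨by simpa [harr, hk'.ne] using g₁, fun j hj => ?_⟩
      rw [List.length_map] at hj
      rw [List.getD_eq_getElem _ _ (by simpa using hj), List.getElem_map, ← g₂ j hj]
      simp [harr]
    · rw [List.getD_eq_default _ _ (by simp)]
      simp
  · intro q hq
    have := hy.piece_le hq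
    rw [hDL, Nat.mul_div_cancel_left _ (by norm_num)] at this
    rwa [List.length_map]
  · rintro s₃ k₃ ⟨⟨g₁, g₂, g₃⟩, hk₃⟩
    refine ⟨⟨_, hy, storesTrails_certTrails g₁ g₂ g₃⟩, ?_⟩
    nlinarith [Nat.zero_le (F₁ * m), Nat.zero_le (F₂ * m)]

/-- Every graph with a `K_{70t+71}`-immersion contains a totally even `K_t`-immersion. Moreover,
one algorithm `P` (the same for all `t`), given a finite graph and the branch trails of a
`K_{70t+71}`-immersion in it, returns the branch trails of a totally even `K_t`-immersion in at most
`C * |E(G)|` steps, where `C` depends only on `t`. -/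
theorem mainTheorem8 :
    (∀ (t : ℕ) (α : Type*) (β : Type*) (G : Graph α β),
      Nonempty (Immersion (cliqueGraph (70 * t + 71)) G) →
        ∃ ψ : Immersion (cliqueGraph t) G, ψ.TotallyEven) ∧
    (∃ P : RamProg, ∀ t : ℕ, ∃ C : ℕ,
      ∀ (n m : ℕ) (G : Graph (Fin n) (Fin m)), V(G) = Set.univ → E(G) = Set.univ →
      ∀ (φ : Immersion (cliqueGraph (70 * t + 71)) G) (L : List (List (Fin m))),
        φ.IsTrailList L →
      ∀ s : RamState, s.StoresGraph G → s.StoresTrails 2 2 3 L →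
        ∃ (s' : RamState) (k : ℕ), RamRuns P s s' k ∧ k ≤ C * E(G).ncard ∧
          ∃ (ψ : Immersion (cliqueGraph t) G) (L' : List (List (Fin m))),
            ψ.TotallyEven ∧ ψ.IsTrailList L' ∧ s'.StoresTrails 3 4 5 L') := by
  refine ⟨fun t α β G ⟨φ⟩ => exists_totallyEven_immersion φ, ?_⟩
  obtain ⟨P, hP⟩ := exists_prog_of_trailData
  refine ⟨.seq scanTrails (.seq labelEnds P), fun t => ?_⟩
  -- `F` becomes a total function; its values at lists without a certificate are arbitrary, but they
  -- are finite and do no harm in the maximum.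
  choose! F hF using hP
  obtain ⟨M, hM⟩ : ∃ M, 2 * M = (70 * t + 71) * (70 * t + 71 - 1) :=
    ⟨_, Nat.mul_div_cancel' (Nat.even_mul_pred_self _).two_dvd⟩
  -- Labels are below `2 * M` and parities below `2`, so `2 * M + 2` bounds both.
  obtain ⟨K, hK⟩ := ((finite_bounded_lists (3 * M) (2 * M + 2)).image F).bddAbove
  -- The factor `2` turns `m + 1` into `2 * m`. This needs an edge, which exists even for `t = 0`,
  -- as `K_71` has branch trails.
  refine ⟨2 * (300 * (M + 1) + 100 * (M + 1) * (M + 1) + K), ?_⟩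
  intro n m G hV hE φ L hL s hG hs
  have hLM : L.length = M := by
    have := hL.two_mul_length
    omega
  have hM₀ : 0 < M := by
    by_contra h
    obtain rfl : M = 0 := by omega
    rw [mul_zero, eq_comm, Nat.mul_eq_zero] at hM
    omega
  have hm : 0 < m := by
    have hmem : L[0] ∈ L := List.getElem_mem (by omega)
    obtain ⟨u, v, -, h⟩ := hL.exists_ends hmem
    obtain ⟨e, -⟩ := List.exists_mem_of_ne_nil _ h.ne_nil
    exact e.pos
  have hcard : E(G).ncard = m := by
    rw [hE, Set.ncard_univ, Nat.card_eq_fintype_card, Fintype.card_fin]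
  have hwp : Wp (.seq scanTrails (.seq labelEnds P)) (fun s' k =>
      k ≤ 2 * (300 * (M + 1) + 100 * (M + 1) * (M + 1) + K) * m ∧
      ∃ (ψ : Immersion (cliqueGraph t) G) (L' : List (List (Fin m))),
        ψ.TotallyEven ∧ ψ.IsTrailList L' ∧ s'.StoresTrails 3 4 5 L') s := by
    refine .seq ((wp_scanTrails hV hG hs fun T hT => ?_).frame.mono ?_)
    · obtain ⟨u, v, -, h⟩ := hL.exists_ends hT
      exact ⟨u, v, h⟩
    rintro s₁ k₁ ⟨⟨h₁, hk₁⟩, hfr₁⟩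
    obtain ⟨hr₁, ha₁⟩ := frame_scanTrails hfr₁
    refine .seq ((wp_labelEnds s₁).frame.mono ?_)
    rintro s₂ k₂ ⟨⟨h₂, hk₂⟩, hfr₂⟩
    obtain ⟨hr₂, ha₂⟩ := frame_labelEnds hfr₂
    have hreg₁ : s₁.reg 2 = L.length := (hr₁ 2 (by norm_num)).trans hs.count
    have hreg₂ : s₂.reg 2 = L.length := (hr₂ 2 (by norm_num)).trans hreg₁
    obtain ⟨x₀⟩ : Nonempty (Fin n) := by
      obtain ⟨⟨a, -⟩, -⟩ := h₁ 0 (by omega)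
      exact ⟨a⟩
    -- The cells of `A₆` read as vertices; beyond the ends of the trails they may be out of range,
    -- and then `x₀` stands in.
    let f : ℕ → Fin n := fun e => if h : s₁.arr 6 e < n then ⟨s₁.arr 6 e, h⟩ else x₀
    have hf₀ : ∀ (e : ℕ) (a : Fin n), s₁.arr 6 e = a → f e = a := fun e a ha => by
      have h : s₁.arr 6 e < n := ha ▸ a.2
      simp only [f, dif_pos h]
      exact Fin.ext ha
    have hf : ∀ (k : ℕ) (hk : k < L.length), IsWalkFromTo G (f (2 * k)) L[k] (f (2 * k + 1)) := by
      intro k hk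
      obtain ⟨⟨a, b, e₁, e₂, hw⟩, -⟩ := h₁ k hk
      rwa [hf₀ _ _ e₁, hf₀ _ _ e₂]
    have hf₁ : ∀ e < 2 * L.length, s₁.arr 6 e = f e := by
      intro e he
      obtain ⟨⟨a, b, e₁, e₂, -⟩, -⟩ := h₁ (e / 2) (by omega)
      rcases Nat.even_or_odd' e with ⟨k, rfl | rfl⟩
      · rw [show 2 * k / 2 = k by omega] at e₁
        rw [e₁, hf₀ _ _ e₁]
      · rw [show (2 * k + 1) / 2 = k by omega] at e₂
        rw [e₂, hf₀ _ _ e₂]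
    have hcert := hL.exists_isCert hf
    have hD : ∀ (e : ℕ) (he : e < (trailData f L).length), s₂.arr 7 e = (trailData f L)[e] := by
      intro e he
      rw [h₂, hreg₁]
      split
      · rename_i h
        rw [firstIndex_congr Fin.val_injective hf₁ h, ← List.getD_eq_getElem _ 0,
          trailData_getD_of_lt h]
      · rename_i h
        rw [length_trailData] at he
        obtain ⟨-, e₁, -⟩ := h₁ (e - 2 * L.length) (by omega)
        rw [show 2 * L.length + (e - 2 * L.length) = e by omega] at e₁
        rw [e₁]
        simp only [trailData]
        rw [List.getElem_append_right (by simpa using h)]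
        simp
    have hFK : F (trailData f L) ≤ K := by
      refine hK ⟨_, ⟨by rw [length_trailData, hLM], fun x hx => ?_⟩, rfl⟩
      simp only [trailData, List.mem_append, List.mem_map, List.mem_range] at hx
      rcases hx with ⟨e, he, rfl⟩ | ⟨T, -, rfl⟩
      · have := firstIndex_le f e
        omega
      · omega
    refine (hF _ hcert m L s₂ hL.nodup_flatten length_trailData hreg₂ ?_ hD).mono ?_
    · intro k hk
      rw [ha₂ 2 (by norm_num), ha₁ 2 (by norm_num), ha₂ 3 (by norm_num), ha₁ 3 (by norm_num),
        ha₂ 8 (by norm_num), (h₁ k hk).2.2]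
      exact ⟨hs.lengths k hk, fun j hj => hs.entry k hk j hj⟩
    · rintro s₃ k₃ ⟨⟨c, hc, hst⟩, hk₃⟩
      refine ⟨?_, ?_⟩
      · rw [hLM] at hk₁
        rw [hreg₁, hLM] at hk₂
        have e₁ : F (trailData f L) * (m + 1) ≤ K * (m + 1) := Nat.mul_le_mul_right _ hFK
        have e₂ : 100 * (M + 1) * (M + 1) ≤ 100 * (M + 1) * (M + 1) * (m + 1) :=
          Nat.le_mul_of_pos_right _ (Nat.succ_pos m)
        calc k₁ + (k₂ + k₃) ≤ (300 * (M + 1) + 100 * (M + 1) * (M + 1) + K) * (m + 1) := by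
              rw [add_mul, add_mul]
              omega
          _ ≤ (300 * (M + 1) + 100 * (M + 1) * (M + 1) + K) * (2 * m) :=
              Nat.mul_le_mul_left _ (by omega)
          _ = _ := by ring
      · obtain ⟨ψ, hψ, hψL⟩ := hc.exists_immersion hf hL.nodup_flatten
        -- The immersion is indexed by the order read from the certificate, which equals `t` only
        -- propositionally, so it has to be transported.
        have key : ∀ t', t' = t → ∀ ψ : Immersion (cliqueGraph t') G, ψ.TotallyEven →
            ψ.IsTrailList (certTrails L c) → ∃ (ψ : Immersion (cliqueGraph t) G)
              (L' : List (List (Fin m))), ψ.TotallyEven ∧ ψ.IsTrailList L' ∧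
              s₃.StoresTrails 3 4 5 L' := by
          rintro t' rfl ψ h h'
          exact ⟨ψ, _, h, h', hst⟩
        exact key _ (hL.certEntry_eq hc) ψ hψ hψL
  obtain ⟨s', k, hr, hk, h⟩ := hwp
  exact ⟨s', k, hr, by rw [hcard]; exact hk, h⟩
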